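/- Let $k\ge 1$, $K>0$, $C\ge 1$, $0<\mu_{\min}\le 1$ and $0<\delta<1$. Let $\Xi$ be a set of designs, and for each $s\in\mathbb N$ put $\Theta_s:=[-\tfrac12,\tfrac12]^s$, with prior density $1$ on $\Theta_s$. Let $\beta\ge1$, $p\in(0,1)$, let $\boldsymbol b=(b_j)_{j\ge1}\in\ell^p(\mathbb N)$ be nonnegative, and let $G_s:\Theta_s\times\Xi\to\mathbb R^k$, $s\in\mathbb N$, be forward models that are smooth in $\boldsymbol\theta$ and satisfy $$\|\partial_{\boldsymbol\theta}^{\boldsymbol\nu}G_s(\boldsymbol\theta,\boldsymbol\xi)\|\le C(|\boldsymbol\nu|!)^\beta\boldsymbol b^{\boldsymbol\nu}\qquad\text{for all }\boldsymbol\theta\in\Theta_s,\ \boldsymbol\nu\in\mathbb N_0^s,\ \boldsymbol\xi\in\Xi$$ in the Euclidean norm. Let $\Gamma\in\mathbb R^{k\times k}$ be symmetric positive definite with all eigenvalues at least $\mu_{\min}$. Put $$f(\boldsymbol\theta,\boldsymbol y)=\frac{1}{\sqrt{\det(2\pi\Gamma)}}\,e^{-\frac12(\boldsymbol y-G_s(\boldsymbol\theta,\boldsymbol\xi))^{\rm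 T}\Gamma^{-1}(\boldsymbol y-G_s(\boldsymbol\theta,\boldsymbol\xi))},\qquad g(\boldsymbol y)=\Big(\int_{\Theta_s}f(\boldsymbol\theta,\boldsymbol y)\,d\boldsymbol\theta\Big)\log\Big(\int_{\Theta_s}f(\boldsymbol\theta,\boldsymbol y)\,d\boldsymbol\theta\Big),$$ $I_{k,K}(g)=\int_{[-K,K]^k}g(\boldsymbol y)\,d\boldsymbol y$, and, for $n,R\ge1$ and a generating vector $\boldsymbol z\in\mathbb N_0^k$, $$\overline Q_{n,R,K}(g)=\frac{(2K)^k}{nR}\sum_{r=1}^R\sum_{i=1}^n g\big(2K\{\boldsymbol t_i+\boldsymbol\Delta_r\}-K\mathbf 1\big),\qquad \boldsymbol t_i=\Big\{\frac{i\boldsymbol z}{n}\Big\},$$ where $\{\cdot\}$ is the componentwise fractional part and $\boldsymbol\Delta_1,\dots,\boldsymbol\Delta_R$ are i.i.d. uniform on $[0,1]^k$. Let $\lambda=\frac1{2-2\delta}$, let $\zeta(x)=\sum_{\ell\ge1}\ell^{-x}$ for $x>1$, and for $\mathfrak u\subseteq\{1,\dots,k\}$ let $$\gamma_{\mathfrak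 u}=\bigg(|\mathfrak u|!\prod_{j\in\mathfrak u}\frac{1.1^k\,k\,\mu_{\min}^{-1/2}\,e^{\frac1{2\mu_{\min}}(kK^2+2\sqrt k\,KC+C^2)}}{\log(2)\sqrt{2\zeta(2\lambda)/(2\pi^2)^\lambda}}\bigg)^{\frac2{1+\lambda}}.$$ The component-by-component (CBC) algorithm with $n$ points and these weights chooses $z_1,\dots,z_k$ in turn, such that $z_d$ minimizes, over the elements of $\{0,\dots,n-1\}$ that are coprime to $n$ and with $z_1,\dots,z_{d-1}$ fixed, the squared shift-averaged worst-case error $$\frac1n\sum_{i=1}^n\ \sum_{\varnothing\ne\mathfrak u\subseteq\{1,\dots,d\}}\gamma_{\mathfrak u}\prod_{j\in\mathfrak u}B_2\Big(\Big\{\frac{iz_j}n\Big\}\Big),\qquad B_2(x)=x^2-x+\tfrac16,$$ of the weighted unanchored Sobolev space of dominating mixed first-order smoothness; ties may be broken in any way. Theorem. There is a constant $c>0$, depending only on $k$, $K$, $C$, $\mu_{\min}$ and $\delta$ (thus not on $n$, $R$, $s$, $\boldsymbol\xi$, $\Xi$, $\Gamma$, $\beta$, $p$, $\boldsymbol b$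 or the forward models), such that in every such situation, for all $s\ge1$, $\boldsymbol\xi\in\Xi$ and $n=2^m$ with $m\ge0$: $g$ is integrable over $[-K,K]^k$; the CBC algorithm has an output; and for every output $\boldsymbol z$ and every $R\ge1$ the error $I_{k,K}(g)-\overline Q_{n,R,K}(g)$ is square integrable in the shifts and satisfies $$\sqrt{\mathbb E_{\boldsymbol\Delta}|I_{k,K}(g)-\overline Q_{n,R,K}(g)|^2}\le c\,n^{-1+\delta}.$$ -/

import Mathlib

namespace QMCDesign

noncomputable section

/-- The parameter domain `Θ_s = [-1/2, 1/2]^s`. -/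
def paramCube (s : ℕ) : Set (Fin s → ℝ) :=
  Set.Icc (fun _ => -(1 / 2 : ℝ)) (fun _ => (1 / 2 : ℝ))

/-- The data domain `[-K, K]^k`. -/
def dataCube (k : ℕ) (K : ℝ) : Set (Fin k → ℝ) :=
  Set.Icc (fun _ => -K) (fun _ => K)

/-- The partial derivative `∂/∂θ_j` of a function on the closed cube `[-1/2, 1/2]^s`
(one-sided where `θ_j = ± 1/2`). -/
def partialDeriv {s : ℕ} {E : Type*} [NormedAddCommGroup E] [NormedSpace ℝ E]
    (j : Fin s) (F : (Fin s → ℝ) → E) : (Fin s → ℝ) → E :=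
  fun θ => derivWithin (fun t : ℝ => F (Function.update θ j t))
    (Set.Icc (-(1 / 2 : ℝ)) (1 / 2)) (θ j)

/-- The mixed partial derivative `∂^ν = ∂_1^{ν_1} ⋯ ∂_s^{ν_s}` for a multi-index `ν`. -/
def mixedPartial {s : ℕ} {E : Type*} [NormedAddCommGroup E] [NormedSpace ℝ E]
    (ν : Fin s → ℕ) (F : (Fin s → ℝ) → E) : (Fin s → ℝ) → E :=
  (List.finRange s).foldr (fun j H => (partialDeriv j)^[ν j] H) F

/-- The Gevrey regularity assumption on a sequence of forward models
`G_s : Θ_s × Ξ → ℝ^k`: each `G_s(·, ξ)` is smooth on `Θ_s`, and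
`‖∂_θ^ν G_s(θ, ξ)‖ ≤ C (|ν|!)^β b^ν` in the Euclidean norm, for all `θ ∈ Θ_s`, all
multi-indices `ν` and all `ξ`. The term `b j` is the entry of number `j + 1` of the sequence. -/
def GevreyRegular {k : ℕ} {Ξ : Type*} (C β : ℝ) (b : ℕ → ℝ)
    (G : (s : ℕ) → (Fin s → ℝ) → Ξ → EuclideanSpace ℝ (Fin k)) : Prop :=
  ∀ s : ℕ, 1 ≤ s → ∀ ξ : Ξ,
    ContDiffOn ℝ ((⊤ : ℕ∞) : WithTop ℕ∞) (fun θ => G s θ ξ) (paramCube s) ∧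
    ∀ ν : Fin s → ℕ, ∀ θ ∈ paramCube s,
      ‖mixedPartial ν (fun θ' => G s θ' ξ) θ‖ ≤
        C * (((∑ j, ν j).factorial : ℝ) ^ β) * ∏ j : Fin s, b j ^ ν j

/-- The weighted norm `‖x‖_{Γ⁻¹} = (xᵀ Γ⁻¹ x)^{1/2}`. -/
def weightedNorm {k : ℕ} (Γ : Matrix (Fin k) (Fin k) ℝ) (x : Fin k → ℝ) : ℝ :=
  Real.sqrt (x ⬝ᵥ (Γ⁻¹.mulVec x))

/-- The normalization `C_{k,Γ} = det(2πΓ)^{-1/2}` of the Gaussian density. -/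
def gaussNorm {k : ℕ} (Γ : Matrix (Fin k) (Fin k) ℝ) : ℝ :=
  1 / Real.sqrt ((2 * Real.pi) • Γ).det

/-- The likelihood `f(θ, y) = C_{k,Γ} exp(-‖y - G(θ)‖²_{Γ⁻¹} / 2)` of a forward map `G`. -/
def likelihood {k s : ℕ} (Γ : Matrix (Fin k) (Fin k) ℝ)
    (G : (Fin s → ℝ) → EuclideanSpace ℝ (Fin k)) (θ : Fin s → ℝ) (y : Fin k → ℝ) : ℝ :=
  gaussNorm Γ * Real.exp (-(1 / 2) * weightedNorm Γ (fun i => y i - G θ i) ^ 2)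

/-- The marginal density `∫_{Θ_s} f(θ, y) dθ` of the data, for the uniform prior on `Θ_s`. -/
def evidence {k s : ℕ} (Γ : Matrix (Fin k) (Fin k) ℝ)
    (G : (Fin s → ℝ) → EuclideanSpace ℝ (Fin k)) (y : Fin k → ℝ) : ℝ :=
  ∫ θ in paramCube s, likelihood Γ G θ y

/-- The outer integrand `g(y) = (∫ f(θ, y) dθ) log (∫ f(θ, y) dθ)`. -/
def outerIntegrand {k s : ℕ} (Γ : Matrix (Fin k) (Fin k) ℝ)
    (G : (Fin s → ℝ) → EuclideanSpace ℝ (Fin k)) (y : Fin k → ℝ) : ℝ :=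
  evidence Γ G y * Real.log (evidence Γ G y)

/-- The integral `I_{k,K}(g)` of `g` over `[-K, K]^k`. -/
def cubeIntegral {k : ℕ} (K : ℝ) (g : (Fin k → ℝ) → ℝ) : ℝ :=
  ∫ y in dataCube k K, g y

/-- The rank-1 lattice point `t_i = {i z / n}`. -/
def latticePoint {k : ℕ} (n : ℕ) (z : Fin k → ℕ) (i : ℕ) : Fin k → ℝ :=
  fun j => Int.fract ((i : ℝ) * (z j : ℝ) / (n : ℝ))

/-- The randomly shifted rank-1 lattice rule with `n` points and `R` shifts, scaled from
`[0, 1]^k` to `[-K, K]^k`; the factor `(2 K)^k` is the volume of `[-K, K]^k`. -/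
def shiftedLatticeRule {k : ℕ} (n R : ℕ) (K : ℝ) (z : Fin k → ℕ) (g : (Fin k → ℝ) → ℝ)
    (Δ : Fin R → Fin k → ℝ) : ℝ :=
  (2 * K) ^ k * (1 / ((n : ℝ) * (R : ℝ))) * ∑ r : Fin R, ∑ i ∈ Finset.Icc 1 n,
    g (fun j => 2 * K * Int.fract (latticePoint n z i j + Δ r j) - K)

/-- The joint law of `R` independent shifts, each of them uniform on `[0, 1]^k`. -/
def shiftLaw (k R : ℕ) : MeasureTheory.Measure (Fin R → Fin k → ℝ) :=
  MeasureTheory.Measure.pi fun _ : Fin R =>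
    (MeasureTheory.volume : MeasureTheory.Measure (Fin k → ℝ)).restrict
      (Set.Icc (fun _ => 0) (fun _ => 1))

/-- The cubature error `I_{k,K}(g) - Q_{n,R,K}(g)` as a function of the shifts. -/
def cubatureError {k : ℕ} (n R : ℕ) (K : ℝ) (z : Fin k → ℕ) (g : (Fin k → ℝ) → ℝ)
    (Δ : Fin R → Fin k → ℝ) : ℝ :=
  cubeIntegral K g - shiftedLatticeRule n R K z g Δ

/-- The root-mean-square error over the random shifts. -/
def rmsError {k : ℕ} (n R : ℕ) (K : ℝ) (z : Fin k → ℕ) (g : (Fin k → ℝ) → ℝ) : ℝ :=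
  Real.sqrt (∫ Δ, |cubatureError n R K z g Δ| ^ 2 ∂(shiftLaw k R))

/-- The squared shift-averaged worst-case error, in the weighted unanchored Sobolev space with
weights `γ`, of the lattice rule in the first coordinates up to and including `d`. It is
`n⁻¹ ∑_{i=1}^n ∑_{∅ ≠ u ⊆ {1, …, d}} γ_u ∏_{j ∈ u} B₂({i z_j / n})`,
with the Bernoulli polynomial `B₂(x) = x² - x + 1/6`. -/
def sqWorstCaseError {k : ℕ} (n : ℕ) (γ : Finset (Fin k) → ℝ) (z : Fin k → ℕ) (d : Fin k) : ℝ :=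
  (1 / (n : ℝ)) * ∑ i ∈ Finset.Icc 1 n,
    ∑ u ∈ (Finset.Iic d).powerset with u.Nonempty,
      γ u * ∏ j ∈ u, bernoulliFun 2 (latticePoint n z i j)

/-- `z` is an output of the component-by-component (CBC) algorithm for `n` points and weights
`γ`: for `d = 1, …, k` in turn, with `z_1, …, z_{d-1}` fixed, the component `z_d` minimizes the
squared shift-averaged worst-case error in the first `d` coordinates over all
`w ∈ {0, …, n - 1}` that are coprime to `n`. Ties may be broken in any way. -/
def IsCBCVector {k : ℕ} (n : ℕ) (γ : Finset (Fin k) → ℝ) (z : Fin k → ℕ) : Prop :=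
  ∀ d : Fin k, (z d < n ∧ Nat.Coprime (z d) n) ∧
    ∀ w : ℕ, w < n → Nat.Coprime w n →
      sqWorstCaseError n γ z d ≤ sqWorstCaseError n γ (Function.update z d w) d

/-- The Riemann zeta function `ζ(x) = ∑_{ℓ ≥ 1} ℓ^{-x}` for real `x > 1`. -/
def zetaReal (x : ℝ) : ℝ := ∑' l : ℕ, ((l : ℝ) + 1) ^ (-x)

/-- The exponent `λ = 1 / (2 - 2δ)`. -/
def lam (δ : ℝ) : ℝ := 1 / (2 - 2 * δ)

/-- The order-dependent weights
`γ_u = (|u|! ∏_{j ∈ u} 1.1^k k μ^{-1/2} e^{(k K² + 2 √k K C + C²) / (2 μ)} /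
  (log 2 √(2 ζ(2 λ) / (2 π²)^λ)))^{2 / (1 + λ)}`. -/
def orderWeight (k : ℕ) (K C μ δ : ℝ) (u : Finset (Fin k)) : ℝ :=
  ((u.card.factorial : ℝ) * ∏ _j ∈ u,
    ((1.1 : ℝ) ^ k * (k : ℝ) * μ ^ (-(1 / 2) : ℝ) *
      Real.exp (1 / (2 * μ) * ((k : ℝ) * K ^ 2 + 2 * Real.sqrt k * K * C + C ^ 2))) /
    (Real.log 2 *
      Real.sqrt (2 * zetaReal (2 * lam δ) / (2 * Real.pi ^ 2) ^ lam δ))) ^ (2 / (1 + lam δ))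

end

end QMCDesign

/-! Averaged over a uniform shift, the squared error of a rank-1 lattice rule is, by Parseval, the
sum of `|c_h|²` over the nonzero frequencies `h` in the dual lattice `n ∣ h·z`, where `c_h` are the
Fourier coefficients of the integrand rescaled to the unit cube. Two independent estimates finish
the proof.

Decay of the coefficients. The quadratic form in the Gaussian is a polynomial in `y`, so the
evidence extends to complex data. In a thin complex box around `[-K, K]^k` the phase of the Gaussian
factor stays in `[-1, 1]`, so the extended evidence has real part bounded below, its principal
logarithm is holomorphic, and `g` extends to a function bounded by some `M`
(`exists_holomorphic_extension`). Only continuity of the forward model and `‖G‖ ≤ C` (the derivative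
bound for `ν = 0`) enter, and the prior is a probability measure; hence the box and `M` are uniform
in `s` and in the model. Cauchy's estimate bounds the mixed differences of `g` by products of
increments (`IsSepHolomorphicOn.norm_mixedDifference_le`). For a function with such differences,
periodic or not, `c_h = O(∏ 1/|h_j|)` over the support of `h` (`norm_integral_mFourier_mul_le`):
rounding a coordinate down to the grid of width `1/|h_j|` makes the integral against the character
vanish, so the function may be replaced by its mixed difference with the rounded point. The squares
decay like the Fourier coefficients of products of `B₂`, so the mean square error is a combination
of the sums `latticeSum n z u` (`integral_sq_norm_lattice_error_le`).

Size of the lattice sums. They are series of nonnegative terms over the dual lattice, hence `(∑ a)^λ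
≤ ∑ a^λ` for `1/2 < λ ≤ 1`. Summed over all choices of one component, the `λ`-th powers stay bounded
independently of `n`: for `n = 2^m` and `h_d ≠ 0`, at most `2^{v₂(h_d)}` choices put a given `h`
into the dual lattice, and this factor does not destroy summability. At least half of all choices
are admissible, so the CBC minimizer is no worse than `O(n^{-1/λ})`
(`exists_latticeSum_le_of_isCBCVector`). The weights enter only through their positivity and change
only the constant. -/

namespace QMCDesign

open Finset MeasureTheory

/-! ### Lattice sums as series over the dual lattice. -/

/-- The product over the coordinates of absolutely convergent series is the absolutely convergent
series of the products, indexed by vectors. -/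
theorem hasSum_pi_prod {𝕜 ι : Type*} [NormedField 𝕜] [CompleteSpace 𝕜] :
    ∀ {k : ℕ} (f : Fin k → ι → 𝕜) (a : Fin k → 𝕜), (∀ j, HasSum (f j) (a j)) →
      (∀ j, Summable fun x => ‖f j x‖) →
      HasSum (fun h : Fin k → ι => ∏ j, f j (h j)) (∏ j, a j) ∧
        Summable fun h : Fin k → ι => ‖∏ j, f j (h j)‖
  | 0, f, a, _, _ => by
    constructor
    · simp
    · exact (hasSum_fintype _).summable
  | k + 1, f, a, hf, hs => by
    obtain ⟨h1, h2⟩ := hasSum_pi_prod (fun j => f j.succ) (fun j => a j.succ)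
      (fun j => hf j.succ) (fun j => hs j.succ)
    have hsum : Summable fun x : ι × (Fin k → ι) =>
        ‖f 0 x.1 * ∏ j : Fin k, f j.succ (x.2 j)‖ := by
      simp only [norm_mul]
      exact (hs 0).mul_of_nonneg h2 (fun _ => norm_nonneg _) (fun _ => norm_nonneg _)
    have hprod := (hf 0).mul h1 hsum.of_norm
    constructor
    · rw [Fin.prod_univ_succ, ← (Fin.consEquiv fun _ : Fin (k + 1) => ι).hasSum_iff]
      refine hprod.congr_fun fun x => ?_
      simp [Fin.consEquiv, Fin.prod_univ_succ]
    · rw [← (Fin.consEquiv fun _ : Fin (k + 1) => ι).summable_iff]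
      refine hsum.congr fun x => ?_
      simp [Fin.consEquiv, Fin.prod_univ_succ]

/-- The decay factor `1 / (2 π² h²)` of the Fourier coefficients of `B₂`, extended by `1` at `0`. -/
noncomputable def decay (h : ℤ) : ℝ := if h = 0 then 1 else 1 / (2 * Real.pi ^ 2 * (h : ℝ) ^ 2)

theorem decay_pos (h : ℤ) : 0 < decay h := by
  unfold decay
  split_ifs with h0
  · exact one_pos
  · have : (h : ℝ) ≠ 0 := by exact_mod_cast h0
    positivity

/-- The support of an integer frequency vector. -/
def freqSupport {k : ℕ} (h : Fin k → ℤ) : Finset (Fin k) := {j | h j ≠ 0}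

/-- The normalized average over the lattice points of `∏_{j ∈ u} B₂`. -/
noncomputable def latticeSum {k : ℕ} (n : ℕ) (z : Fin k → ℕ) (u : Finset (Fin k)) : ℝ :=
  (1 / (n : ℝ)) * ∑ i ∈ Finset.Icc 1 n, ∏ j ∈ u, bernoulliFun 2 (latticePoint n z i j)

theorem sqWorstCaseError_eq {k : ℕ} (n : ℕ) (γ : Finset (Fin k) → ℝ) (z : Fin k → ℕ)
    (d : Fin k) : sqWorstCaseError n γ z d =
      ∑ u ∈ (Finset.Iic d).powerset with u.Nonempty, γ u * latticeSum n z u := by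
  unfold sqWorstCaseError latticeSum
  rw [Finset.sum_comm, Finset.mul_sum]
  refine Finset.sum_congr rfl fun u _ => ?_
  rw [← Finset.mul_sum]
  ring

theorem hasSum_bernoulliFun_two {x : ℝ} (hx : x ∈ Set.Icc (0 : ℝ) 1) :
    HasSum (fun h : ℤ => if h = 0 then 0 else (decay h : ℂ) * fourier h (x : UnitAddCircle))
      (bernoulliFun 2 x : ℂ) := by
  have hpi : (Real.pi : ℂ) ≠ 0 := by exact_mod_cast Real.pi_ne_zero
  have := (hasSum_one_div_pow_mul_fourier_mul_bernoulliFun le_rfl hx).mul_left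
    (1 / (2 * (Real.pi : ℂ) ^ 2))
  convert! this using 1
  · funext h
    unfold decay
    split_ifs with h0
    · simp [h0]
    · push_cast
      have : (h : ℂ) ≠ 0 := by exact_mod_cast h0
      field_simp
  · simp only [mul_pow, Complex.I_sq, Nat.factorial]
    push_cast
    field_simp

theorem summable_norm_bernoulli (y : UnitAddCircle) :
    Summable fun h : ℤ => ‖if h = 0 then 0 else (decay h : ℂ) * fourier h y‖ := by
  have := (Real.summable_one_div_int_pow (p := 2)).2 (by norm_num)
  refine (this.mul_left (1 / (2 * Real.pi ^ 2))).of_nonneg_of_le (fun _ => norm_nonneg _)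
    fun h => ?_
  unfold decay
  split_ifs with h0
  · simp [h0]
  · rw [norm_mul, fourier_apply, Circle.norm_coe, Complex.norm_real, Real.norm_eq_abs,
      abs_of_nonneg (by positivity), mul_one, div_mul_div_comm, one_mul]

theorem sum_pow_eq_zero_of_pow_eq_one {ζ : ℂ} {n : ℕ} (hn : ζ ^ n = 1) (h1 : ζ ≠ 1) :
    ∑ i ∈ Finset.Icc 1 n, ζ ^ i = 0 := by
  rw [← Finset.Ico_add_one_right_eq_Icc, geom_sum_Ico h1 (by omega), pow_succ, hn]
  simp

theorem mFourier_latticePoint {k n : ℕ} (z : Fin k → ℕ) (h : Fin k → ℤ)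
    (i : ℕ) :
    UnitAddTorus.mFourier h (fun j => ((latticePoint n z i j : ℝ) : UnitAddCircle)) =
      Complex.exp (2 * Real.pi * Complex.I * ((∑ j, h j * (z j : ℤ) : ℤ) : ℂ) / n) ^ i := by
  have hcoe : ∀ j, ((latticePoint n z i j : ℝ) : UnitAddCircle) =
      (((i : ℝ) * (z j : ℝ) / (n : ℝ) : ℝ) : UnitAddCircle) := by
    intro j
    unfold latticePoint
    rw [Int.fract, AddCircle.coe_sub]
    have : ((⌊(i : ℝ) * (z j : ℝ) / (n : ℝ)⌋ : ℝ) : UnitAddCircle) = 0 := by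
      rw [AddCircle.coe_eq_zero_iff]
      exact ⟨⌊(i : ℝ) * (z j : ℝ) / (n : ℝ)⌋, by simp⟩
    rw [this, sub_zero]
  simp only [hcoe, UnitAddTorus.mFourier, ContinuousMap.coe_mk, fourier_coe_apply]
  rw [← Complex.exp_sum, ← Complex.exp_nat_mul]
  congr 1
  push_cast
  rw [Finset.mul_sum, Finset.sum_div, Finset.mul_sum]
  refine Finset.sum_congr rfl fun j _ => ?_
  ring

/-- The values are the powers of the `n`-th root of unity `exp(2πi h·z/n)` over a full period: all
equal to `1` if `n ∣ h·z`, a vanishing geometric sum otherwise. -/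
theorem average_mFourier_latticePoint {k : ℕ} {n : ℕ} (hn : n ≠ 0) (z : Fin k → ℕ)
    (h : Fin k → ℤ) :
    (1 / (n : ℂ)) * ∑ i ∈ Finset.Icc 1 n,
      UnitAddTorus.mFourier h (fun j => ((latticePoint n z i j : ℝ) : UnitAddCircle)) =
      if (n : ℤ) ∣ ∑ j, h j * (z j : ℤ) then 1 else 0 := by
  simp only [mFourier_latticePoint]
  set q : ℤ := ∑ j, h j * (z j : ℤ)
  have hn' : (n : ℂ) ≠ 0 := by exact_mod_cast hn
  have hone : Complex.exp (2 * Real.pi * Complex.I * (q : ℂ) / n) = 1 ↔ (n : ℤ) ∣ q := by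
    rw [Complex.exp_eq_one_iff]
    constructor
    · rintro ⟨m, hm⟩
      refine ⟨m, ?_⟩
      have := Complex.two_pi_I_ne_zero
      have h2 : (2 * Real.pi * Complex.I) * (q : ℂ) = (2 * Real.pi * Complex.I) * (n * m) := by
        field_simp at hm
        linear_combination (2 * Real.pi * Complex.I) * hm
      exact_mod_cast mul_left_cancel₀ this h2
    · rintro ⟨m, hm⟩
      refine ⟨m, ?_⟩
      rw [hm]
      push_cast
      field_simp
  split_ifs with hd
  · rw [hone.2 hd]
    simp [hn']
  · rw [sum_pow_eq_zero_of_pow_eq_one _ (fun h1 => hd (hone.1 h1)), mul_zero]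
    rw [← Complex.exp_nat_mul, Complex.exp_eq_one_iff]
    exact ⟨q, by field_simp⟩

/-- Multiply the Fourier series of the factors `B₂` and average the characters over the lattice
points. The positive coefficients make lattice sums nonnegative and allow `λ`-th powers to be taken
termwise. -/
theorem hasSum_latticeSum {k : ℕ} {n : ℕ} (hn : n ≠ 0) (z : Fin k → ℕ) (u : Finset (Fin k)) :
    HasSum (fun h : Fin k → ℤ =>
      if freqSupport h = u ∧ (n : ℤ) ∣ ∑ j, h j * (z j : ℤ) then ∏ j, decay (h j) else 0)
      (latticeSum n z u) := by
  -- A coordinate outside `u` gets the series of the constant `1`, supported at `h = 0`; the product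
  -- series then lives on frequencies with support exactly `u`.
  let f : ℕ → Fin k → ℤ → ℂ := fun i j h => if j ∈ u then
      (if h = 0 then 0 else (decay h : ℂ) * fourier h ((latticePoint n z i j : ℝ) : UnitAddCircle))
    else if h = 0 then 1 else 0
  have hlat : ∀ i j, latticePoint n z i j ∈ Set.Icc (0 : ℝ) 1 := fun i j =>
    ⟨Int.fract_nonneg _, (Int.fract_lt_one _).le⟩
  have hsum : ∀ i, HasSum (fun h : Fin k → ℤ => ∏ j, f i j (h j))
      (∏ j, if j ∈ u then (bernoulliFun 2 (latticePoint n z i j) : ℂ) else 1) := by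
    intro i
    refine (hasSum_pi_prod (f i) _ (fun j => ?_) (fun j => ?_)).1
    · by_cases hj : j ∈ u
      · simpa only [f, hj, if_true] using hasSum_bernoulliFun_two (hlat i j)
      · simpa only [f, hj, if_false] using hasSum_ite_eq (0 : ℤ) (1 : ℂ)
    · by_cases hj : j ∈ u
      · simpa only [f, hj, if_true] using summable_norm_bernoulli _
      · simp only [f, hj, if_false]
        refine (hasSum_ite_eq (0 : ℤ) (1 : ℝ)).summable.congr fun h => ?_
        split_ifs <;> simp
  have hterm : ∀ i (h : Fin k → ℤ), ∏ j, f i j (h j) =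
      (if freqSupport h = u then ∏ j, (decay (h j) : ℂ) else 0) *
        UnitAddTorus.mFourier h (fun j => ((latticePoint n z i j : ℝ) : UnitAddCircle)) := by
    intro i h
    split_ifs with hu
    · simp only [UnitAddTorus.mFourier, ContinuousMap.coe_mk, ← Finset.prod_mul_distrib]
      refine Finset.prod_congr rfl fun j _ => ?_
      have hj : j ∈ u ↔ h j ≠ 0 := by simp [← hu, freqSupport]
      by_cases h0 : h j = 0
      · simp [f, hj, h0, decay]
      · simp [f, hj, h0]
    · rw [zero_mul]
      have : ∃ j, ¬ (j ∈ u ↔ h j ≠ 0) := by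
        by_contra! hcon
        exact hu (by ext j; simp [freqSupport, hcon j])
      obtain ⟨j, hj⟩ := this
      refine Finset.prod_eq_zero (Finset.mem_univ j) ?_
      by_cases h0 : h j = 0 <;> simp_all [f]
  have htot := (hasSum_sum (s := Finset.Icc 1 n) fun i _ => hsum i).mul_left (1 / (n : ℂ))
  simp only [hterm, ← Finset.mul_sum] at htot
  rw [← Complex.hasSum_ofReal]
  convert! htot using 1
  · funext h
    rw [mul_left_comm, average_mFourier_latticePoint hn]
    by_cases h1 : freqSupport h = u <;>
      by_cases h2 : (n : ℤ) ∣ ∑ j, h j * (z j : ℤ) <;> simp [h1, h2]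
  · unfold latticeSum
    push_cast
    simp [Finset.prod_ite_mem]

theorem latticeSum_nonneg {k : ℕ} {n : ℕ} (hn : n ≠ 0) (z : Fin k → ℕ) (u : Finset (Fin k)) :
    0 ≤ latticeSum n z u := by
  refine (hasSum_latticeSum hn z u).nonneg fun h => ?_
  split_ifs
  · exact Finset.prod_nonneg fun j _ => (decay_pos _).le
  · exact le_rfl

theorem latticeSum_congr {k : ℕ} {n : ℕ} {z z' : Fin k → ℕ} {u : Finset (Fin k)}
    (h : ∀ j ∈ u, z j = z' j) : latticeSum n z u = latticeSum n z' u := by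
  unfold latticeSum
  congr 1
  refine Finset.sum_congr rfl fun i _ => Finset.prod_congr rfl fun j hj => ?_
  simp [latticePoint, h j hj]

/-! ### Averaging over one component and the convergence rate of CBC vectors. -/

/-- With `2^i = gcd(2^m, h)`, two solutions are congruent modulo `2^(m-i)`, so each of the `2^i`
blocks of that length contains at most one. -/
theorem card_filter_dvd_add_mul_le (m : ℕ) (q : ℤ) {h : ℤ} (h0 : h ≠ 0) :
    #((Finset.range (2 ^ m)).filter fun w : ℕ => ((2 ^ m : ℕ) : ℤ) ∣ q + h * (w : ℤ)) ≤
      2 ^ padicValNat 2 h.natAbs := by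
  obtain ⟨i, him, hgi⟩ := (Nat.dvd_prime_pow Nat.prime_two).1 (Nat.gcd_dvd_left (2 ^ m) h.natAbs)
  have hih : 2 ^ i ∣ h.natAbs := hgi ▸ Nat.gcd_dvd_right (2 ^ m) h.natAbs
  have hle : i ≤ padicValNat 2 h.natAbs :=
    (padicValNat_dvd_iff_le (Int.natAbs_ne_zero.2 h0)).1 hih
  refine le_trans ?_ (Nat.pow_le_pow_right two_pos hle)
  rw [← Finset.card_range (2 ^ i)]
  refine Finset.card_le_card_of_injOn (fun w => w / 2 ^ (m - i)) ?_ ?_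
  · intro w hw
    simp only [Finset.coe_filter, Finset.mem_range, Set.mem_ofPred_eq, Finset.coe_range,
      Set.mem_Iio] at hw ⊢
    rw [Nat.div_lt_iff_lt_mul (by positivity), ← pow_add]
    have : i + (m - i) = m := by omega
    rw [this]
    exact hw.1
  · intro w hw w' hw' heq
    simp only [Finset.coe_filter, Finset.mem_range, Set.mem_ofPred_eq] at hw hw' heq
    have hd : ((2 ^ m : ℕ) : ℤ) ∣ h * ((w : ℤ) - w') := by
      have hdiff : h * ((w : ℤ) - w') = q + h * w - (q + h * w') := by ring
      rw [hdiff]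
      exact dvd_sub hw.2 hw'.2
    have hd2 : 2 ^ m ∣ h.natAbs * ((w : ℤ) - w').natAbs := by
      rw [← Int.natAbs_mul]
      exact Int.natCast_dvd.1 hd
    have hd3 : 2 ^ (m - i) ∣ ((w : ℤ) - w').natAbs := by
      have h1 : 2 ^ m / Nat.gcd (2 ^ m) h.natAbs ∣ ((w : ℤ) - w').natAbs := by
        refine Nat.Coprime.dvd_of_dvd_mul_left (Nat.coprime_div_gcd_div_gcd
          (Nat.gcd_pos_of_pos_left _ (by positivity))) ?_
        rw [← Nat.mul_div_right_comm (Nat.gcd_dvd_right _ _)]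
        exact Nat.div_dvd_div (Nat.gcd_dvd_left _ _) hd2
      rwa [hgi, Nat.pow_div him two_pos] at h1
    have hmod : w % 2 ^ (m - i) = w' % 2 ^ (m - i) := by
      have : (w' : ℤ) ≡ w [ZMOD ((2 ^ (m - i) : ℕ) : ℤ)] :=
        Int.modEq_iff_dvd.2 (Int.natCast_dvd.2 hd3)
      exact ((Int.natCast_modEq_iff).1 this).symm
    rw [← Nat.div_add_mod w (2 ^ (m - i)), ← Nat.div_add_mod w' (2 ^ (m - i)), heq, hmod]

/-- Write `l = 2^a t` with `a = v₂(l)`. The map `l ↦ (a, t)` is injective and the term factors, so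
the series is part of the product of the geometric series of `2^{a(1-s)}` and the series of
`t^{-s}`. -/
theorem summable_two_pow_padicValNat_mul_rpow {s : ℝ} (hs : 1 < s) :
    Summable fun l : ℕ => (2 : ℝ) ^ padicValNat 2 l * (l : ℝ) ^ (-s) := by
  have hgeo : Summable fun a : ℕ => (2 : ℝ) ^ a * ((2 : ℝ) ^ a) ^ (-s) := by
    have hlt : (2 : ℝ) * 2 ^ (-s) < 1 := by
      have : (2 : ℝ) * 2 ^ (-s) = 2 ^ (1 + -s) := by
        rw [Real.rpow_add two_pos, Real.rpow_one]
      rw [this]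
      exact Real.rpow_lt_one_of_one_lt_of_neg one_lt_two (by linarith)
    refine (summable_geometric_of_lt_one (by positivity) hlt).congr fun a => ?_
    rw [mul_pow, ← Real.rpow_natCast (2 ^ (-s)), ← Real.rpow_mul two_pos.le, mul_comm (-s),
      Real.rpow_mul two_pos.le, Real.rpow_natCast]
  have hzeta : Summable fun t : ℕ => (t : ℝ) ^ (-s) := Real.summable_nat_rpow.2 (by linarith)
  have hprod := hgeo.mul_of_nonneg hzeta (fun _ => by positivity) (fun _ => by positivity)
  have hfac : ∀ l : ℕ, 2 ^ padicValNat 2 l * (l / 2 ^ padicValNat 2 l) = l := fun l =>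
    Nat.mul_div_cancel' pow_padicValNat_dvd
  have hinj : Function.Injective
      fun l : ℕ => (padicValNat 2 l, l / 2 ^ padicValNat 2 l) := by
    intro l l' hl
    simp only [Prod.mk.injEq] at hl
    rw [← hfac l, ← hfac l', hl.1]
    rw [hl.1] at hl
    rw [hl.2]
  refine (hprod.comp_injective hinj).congr fun l => ?_
  simp only [Function.comp]
  rw [mul_assoc, ← Real.mul_rpow (by positivity) (by positivity)]
  congr 2
  exact_mod_cast hfac l

/-- The `r`-th power of the decay factor, multiplied by the largest power of two dividing the
frequency. -/
noncomputable def dyadicDecay (r : ℝ) (h : ℤ) : ℝ := decay h ^ r * 2 ^ padicValNat 2 h.natAbs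

theorem dyadicDecay_pos (r : ℝ) (h : ℤ) : 0 < dyadicDecay r h :=
  mul_pos (Real.rpow_pos_of_pos (decay_pos h) _) (by positivity)

theorem summable_dyadicDecay {r : ℝ} (hr : 1 / 2 < r) : Summable (dyadicDecay r) := by
  have hN := (summable_two_pow_padicValNat_mul_rpow (s := 2 * r) (by linarith)).mul_left
    ((1 / (2 * Real.pi ^ 2)) ^ r)
  have hval : ∀ h : ℤ, h ≠ 0 → dyadicDecay r h = (1 / (2 * Real.pi ^ 2)) ^ r *
      ((2 : ℝ) ^ padicValNat 2 h.natAbs * (h.natAbs : ℝ) ^ (-(2 * r))) := by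
    intro h h0
    have habs : (h.natAbs : ℝ) = |(h : ℝ)| := by
      rw [Nat.cast_natAbs, Int.cast_abs]
    unfold dyadicDecay decay
    rw [if_neg h0, habs, ← sq_abs (h : ℝ), Real.rpow_neg (abs_nonneg _),
      Real.rpow_mul (abs_nonneg _), Real.rpow_two, ← one_div_mul_one_div,
      Real.mul_rpow (by positivity) (by positivity), Real.div_rpow zero_le_one (sq_nonneg _) r,
      Real.one_rpow]
    ring
  have hN1 := (summable_nat_add_iff 1).2 hN
  refine Summable.of_nat_of_neg ?_ ?_
  · rw [← summable_nat_add_iff 1]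
    refine hN1.congr fun l => ?_
    rw [hval _ (by omega)]
    congr 3
  · rw [← summable_nat_add_iff 1]
    refine hN1.congr fun l => ?_
    rw [hval _ (by omega), Int.natAbs_neg]
    congr 3

theorem summable_prod_dyadicDecay {r : ℝ} (hr : 1 / 2 < r) (k : ℕ) :
    Summable fun h : Fin k → ℤ => ∏ j, dyadicDecay r (h j) := by
  have hn : ∀ h, ‖dyadicDecay r h‖ = dyadicDecay r h := fun h =>
    Real.norm_of_nonneg (dyadicDecay_pos r h).le
  refine ((hasSum_pi_prod (fun _ : Fin k => dyadicDecay r) _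
    (fun _ => (summable_dyadicDecay hr).hasSum) (fun _ => ?_)).1).summable
  simpa only [hn] using summable_dyadicDecay hr

/-- Subadditivity of `x ↦ x^r` for `r ≤ 1`. Averaging `r`-th powers instead of the errors themselves
is what improves the rate from `n^{-1}` to `n^{-1/r}`. -/
theorem rpow_sum_le_sum_rpow {ι : Type*} (s : Finset ι) {f : ι → ℝ} (hf : ∀ i, 0 ≤ f i) {r : ℝ}
    (hr0 : 0 < r) (hr1 : r ≤ 1) : (∑ i ∈ s, f i) ^ r ≤ ∑ i ∈ s, f i ^ r := by
  classical
  induction s using Finset.induction_on with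
  | empty => simp [Real.zero_rpow hr0.ne']
  | insert i s hi ih =>
    rw [Finset.sum_insert hi, Finset.sum_insert hi]
    refine le_trans (Real.rpow_add_le_add_rpow (hf i) (Finset.sum_nonneg fun i _ => hf i)
      hr0.le hr1) ?_
    gcongr

theorem rpow_le_tsum_rpow {ι : Type*} {f : ι → ℝ} {a : ℝ} (hf : ∀ i, 0 ≤ f i) (ha : HasSum f a)
    {r : ℝ} (hr0 : 0 < r) (hr1 : r ≤ 1) (hs : Summable fun i => f i ^ r) :
    a ^ r ≤ ∑' i, f i ^ r := by
  have hlim : Filter.Tendsto (fun s : Finset ι => (∑ i ∈ s, f i) ^ r) Filter.atTop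
      (nhds (a ^ r)) := (Real.continuousAt_rpow_const _ _ (Or.inr hr0.le)).tendsto.comp ha
  refine le_of_tendsto' hlim fun s => (rpow_sum_le_sum_rpow s hf hr0 hr1).trans ?_
  exact hs.sum_le_tsum s fun i _ => Real.rpow_nonneg (hf i) _

theorem two_mul_card_coprime_ge (m : ℕ) :
    2 ^ m ≤ 2 * #{w ∈ Finset.range (2 ^ m) | Nat.Coprime w (2 ^ m)} := by
  have hphi : #{w ∈ Finset.range (2 ^ m) | Nat.Coprime w (2 ^ m)} = Nat.totient (2 ^ m) := by
    unfold Nat.totient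
    simp only [Nat.coprime_comm]
  rw [hphi]
  rcases m with _ | m
  · simp
  · rw [Nat.totient_prime_pow_succ Nat.prime_two, pow_succ]
    omega

/-- Averaging `λ`-th powers of the lattice sums over all choices of one component. -/
theorem sum_latticeSum_update_rpow_le {k : ℕ} (m : ℕ) (z : Fin k → ℕ) {u : Finset (Fin k)}
    {d : Fin k} (hd : d ∈ u) {r : ℝ} (hr0 : 1 / 2 < r) (hr1 : r ≤ 1) :
    ∑ w ∈ Finset.range (2 ^ m), latticeSum (2 ^ m) (Function.update z d w) u ^ r ≤
      ∑' h : Fin k → ℤ, ∏ j, dyadicDecay r (h j) := by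
  have hn : (2 ^ m : ℕ) ≠ 0 := by positivity
  have hrpos : 0 < r := by linarith
  have hS := summable_prod_dyadicDecay hr0 k
  let F : ℕ → (Fin k → ℤ) → ℝ := fun w h =>
    if freqSupport h = u ∧ ((2 ^ m : ℕ) : ℤ) ∣ ∑ j, h j * (Function.update z d w j : ℤ) then
      ∏ j, decay (h j) else 0
  have hF0 : ∀ w h, 0 ≤ F w h := by
    intro w h
    simp only [F]
    split_ifs
    · exact Finset.prod_nonneg fun j _ => (decay_pos _).le
    · exact le_rfl
  have hsplit : ∀ h : Fin k → ℤ, ∏ j, dyadicDecay r (h j) =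
      (∏ j, decay (h j)) ^ r * ∏ j, (2 : ℝ) ^ padicValNat 2 (h j).natAbs := by
    intro h
    rw [← Real.finsetProd_rpow _ _ fun j _ => (decay_pos _).le, ← Finset.prod_mul_distrib]
    rfl
  have hprod0 : ∀ h : Fin k → ℤ, 0 ≤ (∏ j, decay (h j)) ^ r := fun h =>
    Real.rpow_nonneg (Finset.prod_nonneg fun j _ => (decay_pos _).le) _
  have hge1 : ∀ h : Fin k → ℤ, ∀ j, (1 : ℝ) ≤ 2 ^ padicValNat 2 (h j).natAbs := fun h j =>
    one_le_pow₀ one_le_two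
  have hone : ∀ (h : Fin k → ℤ) (s : Finset (Fin k)),
      (1 : ℝ) ≤ ∏ j ∈ s, (2 : ℝ) ^ padicValNat 2 (h j).natAbs := fun h s => by
    simpa using Finset.prod_le_prod (s := s) (fun _ _ => zero_le_one) fun j _ => hge1 h j
  have hFr : ∀ w h, F w h ^ r =
      if freqSupport h = u ∧ ((2 ^ m : ℕ) : ℤ) ∣ ∑ j, h j * (Function.update z d w j : ℤ) then
        (∏ j, decay (h j)) ^ r else 0 := by
    intro w h
    simp only [F]
    split_ifs
    · rfl
    · exact Real.zero_rpow hrpos.ne'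
  have hFle : ∀ w h, F w h ^ r ≤ ∏ j, dyadicDecay r (h j) := by
    intro w h
    rw [hFr, hsplit]
    split_ifs
    · exact le_mul_of_one_le_right (hprod0 h) (hone h _)
    · exact mul_nonneg (hprod0 h) (Finset.prod_nonneg fun j _ => by positivity)
  have hFs : ∀ w, Summable fun h => F w h ^ r := fun w =>
    hS.of_nonneg_of_le (fun h => Real.rpow_nonneg (hF0 w h) _) (hFle w)
  calc ∑ w ∈ Finset.range (2 ^ m), latticeSum (2 ^ m) (Function.update z d w) u ^ r
      ≤ ∑ w ∈ Finset.range (2 ^ m), ∑' h, F w h ^ r := Finset.sum_le_sum fun w _ =>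
        rpow_le_tsum_rpow (hF0 w) (hasSum_latticeSum hn _ u) hrpos hr1 (hFs w)
    _ = ∑' h, ∑ w ∈ Finset.range (2 ^ m), F w h ^ r :=
        (Summable.tsum_finsetSum fun w _ => hFs w).symm
    _ ≤ ∑' h : Fin k → ℤ, ∏ j, dyadicDecay r (h j) := by
        refine Summable.tsum_le_tsum (fun h => ?_) (summable_sum fun w _ => hFs w) hS
        simp only [hFr]
        by_cases hu : freqSupport h = u
        · have hd0 : h d ≠ 0 := by
            rw [← hu] at hd
            simpa [freqSupport] using hd
          have hdot : ∀ w : ℕ, ∑ j, h j * (Function.update z d w j : ℤ) =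
              ∑ j ∈ Finset.univ.erase d, h j * (z j : ℤ) + h d * (w : ℤ) := by
            intro w
            rw [← Finset.sum_erase_add _ _ (Finset.mem_univ d), Function.update_self]
            congr 1
            refine Finset.sum_congr rfl fun j hj => ?_
            rw [Function.update_of_ne (Finset.ne_of_mem_erase hj)]
          simp only [hu, true_and, hdot]
          rw [← Finset.sum_filter, Finset.sum_const, nsmul_eq_mul, hsplit, mul_comm]
          refine mul_le_mul_of_nonneg_left ?_ (hprod0 h)
          calc _ ≤ ((2 ^ padicValNat 2 (h d).natAbs : ℕ) : ℝ) := by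
                exact_mod_cast card_filter_dvd_add_mul_le m _ hd0
            _ = 2 ^ padicValNat 2 (h d).natAbs := by push_cast; rfl
            -- The other factors are at least `1`; including them gives a bound that depends on
            -- neither `d` nor `u`.
            _ ≤ ∏ j, (2 : ℝ) ^ padicValNat 2 (h j).natAbs := by
                rw [← Finset.mul_prod_erase _ _ (Finset.mem_univ d)]
                exact le_mul_of_one_le_right (by positivity)
                  (hone h _)
        · simp only [hu, false_and, if_false, Finset.sum_const_zero]
          exact Finset.prod_nonneg fun j _ => (dyadicDecay_pos r _).le

/-- A minimizing component makes the part of the worst-case error which involves it at most as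
large as for every other admissible choice. -/
theorem IsCBCVector.sum_latticeSum_le {k n : ℕ} {γ : Finset (Fin k) → ℝ} {z : Fin k → ℕ}
    (hz : IsCBCVector n γ z) (d : Fin k) {w : ℕ} (hw : w < n) (hwn : Nat.Coprime w n) :
    ∑ u ∈ (Finset.Iic d).powerset with d ∈ u, γ u * latticeSum n z u ≤
      ∑ u ∈ (Finset.Iic d).powerset with d ∈ u,
        γ u * latticeSum n (Function.update z d w) u := by
  have h := (hz d).2 w hw hwn
  have hsplit : ∀ z' : Fin k → ℕ, sqWorstCaseError n γ z' d =
      (∑ u ∈ (Finset.Iic d).powerset with d ∈ u, γ u * latticeSum n z' u) +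
      ∑ u ∈ (Finset.Iic d).powerset with (u.Nonempty ∧ d ∉ u), γ u * latticeSum n z' u := by
    intro z'
    rw [sqWorstCaseError_eq, ← Finset.sum_filter_add_sum_filter_not _ (fun u => d ∈ u),
      Finset.filter_filter, Finset.filter_filter]
    congr 2
    ext u
    simp only [Finset.mem_filter, and_congr_right_iff, and_iff_right_iff_imp]
    exact fun _ hd => ⟨d, hd⟩
  have hrest : ∑ u ∈ (Finset.Iic d).powerset with (u.Nonempty ∧ d ∉ u), γ u * latticeSum n z u =
      ∑ u ∈ (Finset.Iic d).powerset with (u.Nonempty ∧ d ∉ u),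
        γ u * latticeSum n (Function.update z d w) u := by
    refine Finset.sum_congr rfl fun u hu => ?_
    rw [latticeSum_congr (z := z) (z' := Function.update z d w)]
    intro j hj
    rw [Function.update_of_ne]
    rintro rfl
    exact (Finset.mem_filter.1 hu).2.2 hj
  rw [hsplit, hsplit, hrest] at h
  linarith

/-- The lattice sums of CBC vectors for `n = 2 ^ m` points decay at the rate `n ^ (-1 / r)`. -/
theorem exists_latticeSum_le_of_isCBCVector {k : ℕ} {γ : Finset (Fin k) → ℝ} (hγ : ∀ u, 0 < γ u)
    {r : ℝ} (hr0 : 1 / 2 < r) (hr1 : r ≤ 1) :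
    ∃ B : ℝ, 0 ≤ B ∧ ∀ (m : ℕ) (z : Fin k → ℕ), IsCBCVector (2 ^ m) γ z →
      ∀ u : Finset (Fin k), u.Nonempty →
        latticeSum (2 ^ m) z u ≤ B * ((2 ^ m : ℕ) : ℝ) ^ (-(1 / r)) := by
  have hrpos : 0 < r := by linarith
  set S : ℝ := ∑' h : Fin k → ℤ, ∏ j, dyadicDecay r (h j)
  have hS0 : 0 ≤ S := tsum_nonneg fun h => Finset.prod_nonneg fun j _ => (dyadicDecay_pos r _).le
  -- The factor `2` pays for the restriction to components coprime to `n`, which are at least half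
  -- of all.
  set A : ℝ := 2 * ∑ u : Finset (Fin k), γ u ^ r * S
  have hA0 : 0 ≤ A := mul_nonneg two_pos.le
    (Finset.sum_nonneg fun u _ => mul_nonneg (Real.rpow_nonneg (hγ u).le _) hS0)
  have hinv : ∀ u, 0 ≤ (γ u)⁻¹ := fun u => (inv_pos.2 (hγ u)).le
  refine ⟨A ^ (1 / r) * ∑ u : Finset (Fin k), (γ u)⁻¹,
    mul_nonneg (Real.rpow_nonneg hA0 _) (Finset.sum_nonneg fun u _ => hinv u), ?_⟩
  intro m z hz u hu
  have hn : (2 ^ m : ℕ) ≠ 0 := by positivity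
  have hnR : (0 : ℝ) < ((2 ^ m : ℕ) : ℝ) := by positivity
  -- For `d = max u`, the term of `u` belongs to the part of the error that is minimized in step
  -- `d`; its other terms are nonnegative and can be dropped.
  set d := u.max' hu
  have hud : d ∈ u := u.max'_mem hu
  set θ : (Fin k → ℕ) → ℝ := fun z' =>
    ∑ u ∈ (Finset.Iic d).powerset with d ∈ u, γ u * latticeSum (2 ^ m) z' u
  have hterm0 : ∀ z' v, 0 ≤ γ v * latticeSum (2 ^ m) z' v := fun z' v =>
    mul_nonneg (hγ v).le (latticeSum_nonneg hn z' v)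
  have hθ0 : ∀ z', 0 ≤ θ z' := fun z' => Finset.sum_nonneg fun v _ => hterm0 z' v
  have hcard : ((2 ^ m : ℕ) : ℝ) * θ z ^ r ≤ A := by
    have h1 : (#{w ∈ Finset.range (2 ^ m) | Nat.Coprime w (2 ^ m)} : ℝ) * θ z ^ r ≤
        ∑ u : Finset (Fin k), γ u ^ r * S := by
      calc (#{w ∈ Finset.range (2 ^ m) | Nat.Coprime w (2 ^ m)} : ℝ) * θ z ^ r
          = ∑ w ∈ Finset.range (2 ^ m) with Nat.Coprime w (2 ^ m), θ z ^ r := by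
            rw [Finset.sum_const, nsmul_eq_mul]
        _ ≤ ∑ w ∈ Finset.range (2 ^ m) with Nat.Coprime w (2 ^ m),
              θ (Function.update z d w) ^ r := by
            refine Finset.sum_le_sum fun w hw => ?_
            rw [Finset.mem_filter, Finset.mem_range] at hw
            exact Real.rpow_le_rpow (hθ0 z) (hz.sum_latticeSum_le d hw.1 hw.2) hrpos.le
        _ ≤ ∑ w ∈ Finset.range (2 ^ m), θ (Function.update z d w) ^ r :=
            Finset.sum_le_sum_of_subset_of_nonneg (Finset.filter_subset _ _)
              fun w _ _ => Real.rpow_nonneg (hθ0 _) _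
        _ ≤ ∑ w ∈ Finset.range (2 ^ m), ∑ v ∈ (Finset.Iic d).powerset with d ∈ v,
              γ v ^ r * latticeSum (2 ^ m) (Function.update z d w) v ^ r := by
            refine Finset.sum_le_sum fun w _ => ?_
            refine (rpow_sum_le_sum_rpow _ (fun v => hterm0 _ v) hrpos hr1).trans_eq ?_
            refine Finset.sum_congr rfl fun v _ => ?_
            rw [Real.mul_rpow (hγ v).le (latticeSum_nonneg hn _ v)]
        _ = ∑ v ∈ (Finset.Iic d).powerset with d ∈ v, γ v ^ r *
              ∑ w ∈ Finset.range (2 ^ m), latticeSum (2 ^ m) (Function.update z d w) v ^ r := by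
            rw [Finset.sum_comm]
            simp only [Finset.mul_sum]
        _ ≤ ∑ v ∈ (Finset.Iic d).powerset with d ∈ v, γ v ^ r * S := by
            refine Finset.sum_le_sum fun v hv => ?_
            exact mul_le_mul_of_nonneg_left
              (sum_latticeSum_update_rpow_le m z (Finset.mem_filter.1 hv).2 hr0 hr1)
              (Real.rpow_nonneg (hγ v).le _)
        _ ≤ ∑ u : Finset (Fin k), γ u ^ r * S :=
            Finset.sum_le_sum_of_subset_of_nonneg (Finset.subset_univ _)
              fun v _ _ => mul_nonneg (Real.rpow_nonneg (hγ v).le _) hS0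
    have h2 : ((2 ^ m : ℕ) : ℝ) ≤
        2 * (#{w ∈ Finset.range (2 ^ m) | Nat.Coprime w (2 ^ m)} : ℝ) := by
      exact_mod_cast two_mul_card_coprime_ge m
    calc ((2 ^ m : ℕ) : ℝ) * θ z ^ r
        ≤ 2 * (#{w ∈ Finset.range (2 ^ m) | Nat.Coprime w (2 ^ m)} : ℝ) * θ z ^ r :=
          mul_le_mul_of_nonneg_right h2 (Real.rpow_nonneg (hθ0 z) _)
      _ ≤ A := by rw [mul_assoc]; exact mul_le_mul_of_nonneg_left h1 two_pos.le
  have hθ : θ z ≤ A ^ (1 / r) * ((2 ^ m : ℕ) : ℝ) ^ (-(1 / r)) := by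
    have h1 : θ z ^ r ≤ A * ((2 ^ m : ℕ) : ℝ)⁻¹ := by
      rw [← div_eq_mul_inv, le_div_iff₀ hnR, mul_comm]
      exact hcard
    have h2 := Real.rpow_le_rpow (Real.rpow_nonneg (hθ0 z) _) h1 (by positivity : 0 ≤ 1 / r)
    rw [← Real.rpow_mul (hθ0 z), mul_one_div_cancel hrpos.ne', Real.rpow_one,
      Real.mul_rpow hA0 (by positivity), Real.inv_rpow hnR.le, ← Real.rpow_neg hnR.le] at h2
    exact h2
  have hmem : u ∈ (Finset.Iic d).powerset.filter fun u => d ∈ u := by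
    rw [Finset.mem_filter, Finset.mem_powerset]
    exact ⟨fun j hj => Finset.mem_Iic.2 (u.le_max' j hj), hud⟩
  have hle : γ u * latticeSum (2 ^ m) z u ≤ θ z :=
    Finset.single_le_sum (f := fun v => γ v * latticeSum (2 ^ m) z v)
      (fun v _ => hterm0 z v) hmem
  calc latticeSum (2 ^ m) z u = (γ u)⁻¹ * (γ u * latticeSum (2 ^ m) z u) := by
        rw [inv_mul_cancel_left₀ (hγ u).ne']
    _ ≤ (∑ v, (γ v)⁻¹) * (A ^ (1 / r) * ((2 ^ m : ℕ) : ℝ) ^ (-(1 / r))) :=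
        mul_le_mul (Finset.single_le_sum (fun v _ => hinv v) (Finset.mem_univ u))
          (hle.trans hθ) (hterm0 z u) (Finset.sum_nonneg fun v _ => hinv v)
    _ = _ := by ring

/-- Ensures that the minimality reached in step `d` survives the choice of later components. -/
theorem sqWorstCaseError_congr {k n : ℕ} {γ : Finset (Fin k) → ℝ} {z z' : Fin k → ℕ} {d : Fin k}
    (h : ∀ j ≤ d, z j = z' j) : sqWorstCaseError n γ z d = sqWorstCaseError n γ z' d := by
  rw [sqWorstCaseError_eq, sqWorstCaseError_eq]
  refine Finset.sum_congr rfl fun u hu => ?_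
  rw [Finset.mem_filter, Finset.mem_powerset] at hu
  rw [latticeSum_congr fun j hj => h j (Finset.mem_Iic.1 (hu.1 hj))]

/-- The component-by-component algorithm has an output. -/
theorem exists_isCBCVector {k n : ℕ} (hn : 1 ≤ n) (γ : Finset (Fin k) → ℝ) :
    ∃ z : Fin k → ℕ, IsCBCVector n γ z := by
  have hstep : ∀ m ≤ k, ∃ z : Fin k → ℕ, ∀ d : Fin k, (d : ℕ) < m →
      (z d < n ∧ Nat.Coprime (z d) n) ∧ ∀ w : ℕ, w < n → Nat.Coprime w n →
        sqWorstCaseError n γ z d ≤ sqWorstCaseError n γ (Function.update z d w) d := by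
    intro m
    induction m with
    | zero => exact fun _ => ⟨fun _ => 0, fun d hd => absurd hd (Nat.not_lt_zero _)⟩
    | succ m ih =>
      intro hm
      obtain ⟨z, hz⟩ := ih (by omega)
      let e : Fin k := ⟨m, hm⟩
      have hne : {w ∈ Finset.range n | Nat.Coprime w n}.Nonempty := by
        -- The reduction modulo `n` covers `n = 1`, where the only candidate is `0`, which is
        -- coprime to `1`.
        refine ⟨1 % n, ?_⟩
        rw [Finset.mem_filter, Finset.mem_range]
        refine ⟨Nat.mod_lt _ hn, ?_⟩
        rcases hn.eq_or_lt with rfl | h1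
        · simp
        · rw [Nat.mod_eq_of_lt h1]
          exact Nat.coprime_one_left n
      obtain ⟨v, hv, hmin⟩ := Finset.exists_min_image _
        (fun w => sqWorstCaseError n γ (Function.update z e w) e) hne
      rw [Finset.mem_filter, Finset.mem_range] at hv
      refine ⟨Function.update z e v, fun d hd => ?_⟩
      by_cases hde : d = e
      · subst hde
        rw [Function.update_self]
        refine ⟨hv, fun w hw hwn => ?_⟩
        rw [Function.update_idem]
        exact hmin w (by rw [Finset.mem_filter, Finset.mem_range]; exact ⟨hw, hwn⟩)
      · have hlt : d < e := by
          have : (d : ℕ) ≠ m := fun h => hde (Fin.ext h)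
          exact Fin.lt_def.2 (show (d : ℕ) < m by omega)
        have hagree : ∀ j ≤ d, Function.update z e v j = z j := fun j hj =>
          Function.update_of_ne (hj.trans_lt hlt).ne _ _
        rw [hagree d le_rfl]
        obtain ⟨h1, h2⟩ := hz d hlt
        refine ⟨h1, fun w hw hwn => ?_⟩
        rw [sqWorstCaseError_congr hagree]
        refine (h2 w hw hwn).trans_eq (sqWorstCaseError_congr fun j hj => ?_)
        by_cases hjd : j = d
        · subst hjd
          simp
        · rw [Function.update_of_ne hjd, Function.update_of_ne hjd, hagree j hj]
  obtain ⟨z, hz⟩ := hstep k le_rfl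
  exact ⟨z, fun d => hz d d.2⟩

/-! ### Mixed differences of separately holomorphic functions. -/

/-- `F` is bounded by `M` on `U ^ k` and holomorphic there in each variable. -/
def IsSepHolomorphicOn {k : ℕ} (U : Set ℂ) (M : ℝ) (F : (Fin k → ℂ) → ℂ) : Prop :=
  (∀ z : Fin k → ℂ, (∀ i, z i ∈ U) → ‖F z‖ ≤ M) ∧
    ∀ (j : Fin k) (z : Fin k → ℂ), (∀ i, z i ∈ U) →
      DifferentiableOn ℂ (fun t => F (Function.update z j t)) U

/-- Cauchy's estimate on discs of radius `r` bounds the derivative on `S` by `M / r`; the mean value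
inequality on the convex set `S` does the rest. -/
theorem norm_sub_le_of_differentiableOn {U S : Set ℂ} {r M : ℝ} (hr : 0 < r)
    (hS : Convex ℝ S) (hSU : ∀ t ∈ S, Metric.closedBall t r ⊆ U) {f : ℂ → ℂ}
    (hf : DifferentiableOn ℂ f U) (hM : ∀ t ∈ U, ‖f t‖ ≤ M) {a b : ℂ} (ha : a ∈ S) (hb : b ∈ S) :
    ‖f a - f b‖ ≤ M / r * ‖a - b‖ := by
  refine hS.norm_image_sub_le_of_norm_deriv_le (fun t ht => ?_) (fun t ht => ?_) hb ha
  · exact hf.differentiableAt (Filter.mem_of_superset (Metric.closedBall_mem_nhds t hr) (hSU t ht))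
  · exact Complex.norm_deriv_le_of_forall_mem_sphere_norm_le hr
      ((hf.mono (hSU t ht)).diffContOnCl_ball subset_rfl)
      fun w hw => hM w (hSU t ht (Metric.sphere_subset_closedBall hw))

/-- The difference is again bounded and separately holomorphic on the same `U`, being constant in
coordinate `j`. Thus differences in further coordinates can be taken without shrinking the domain.
-/
theorem IsSepHolomorphicOn.difference {k : ℕ} {U S : Set ℂ} {r M : ℝ} (hr : 0 < r)
    (hS : Convex ℝ S) (hSU : ∀ t ∈ S, Metric.closedBall t r ⊆ U) {F : (Fin k → ℂ) → ℂ}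
    (hF : IsSepHolomorphicOn U M F) (j : Fin k) {a b : ℂ} (ha : a ∈ S) (hb : b ∈ S) :
    IsSepHolomorphicOn U (M / r * ‖a - b‖)
      fun z => F (Function.update z j a) - F (Function.update z j b) := by
  have haU : a ∈ U := hSU a ha (Metric.mem_closedBall_self hr.le)
  have hbU : b ∈ U := hSU b hb (Metric.mem_closedBall_self hr.le)
  have hupd : ∀ z : Fin k → ℂ, (∀ i, z i ∈ U) → ∀ t ∈ U, ∀ i, Function.update z j t i ∈ U := by
    intro z hz t ht i
    by_cases hij : i = j
    · subst hij; simpa using ht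
    · simpa [Function.update_of_ne hij] using hz i
  refine ⟨fun z hz => ?_, fun i z hz => ?_⟩
  · exact norm_sub_le_of_differentiableOn hr hS hSU (hF.2 j z hz)
      (fun t ht => hF.1 _ (hupd z hz t ht)) ha hb
  · by_cases hij : i = j
    · subst hij
      simp only [Function.update_idem]
      exact differentiableOn_const _
    · simp only [Function.update_comm hij]
      exact (hF.2 i _ (hupd z hz a haU)).sub (hF.2 i _ (hupd z hz b hbU))

/-- Mixed differences of separately holomorphic functions are bounded by the product of the
increments. -/
theorem IsSepHolomorphicOn.norm_mixedDifference_le {k : ℕ} {U S : Set ℂ} {r : ℝ} (hr : 0 < r)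
    (hS : Convex ℝ S) (hSU : ∀ t ∈ S, Metric.closedBall t r ⊆ U) {a b : Fin k → ℂ}
    (ha : ∀ i, a i ∈ S) (hb : ∀ i, b i ∈ S) (u : Finset (Fin k)) :
    ∀ {M : ℝ} {F : (Fin k → ℂ) → ℂ}, IsSepHolomorphicOn U M F →
      ‖∑ v ∈ u.powerset, (-1 : ℂ) ^ #v * F (v.piecewise b a)‖ ≤
        M * ∏ j ∈ u, (1 / r * ‖a j - b j‖) := by
  induction u using Finset.induction_on with
  | empty =>
    intro M F hF
    simpa using hF.1 a fun i => hSU _ (ha i) (Metric.mem_closedBall_self hr.le)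
  | insert j u hj ih =>
    intro M F hF
    rw [Finset.sum_powerset_insert hj, ← Finset.sum_add_distrib, Finset.prod_insert hj]
    have hG := ih (hF.difference hr hS hSU j (ha j) (hb j))
    -- Pairing `v` with `insert j v` turns the signed sum over `insert j u` into that of the
    -- difference function over `u`.
    refine le_of_eq_of_le ?_ (hG.trans_eq ?_)
    · congr 1
      refine Finset.sum_congr rfl fun v hv => ?_
      have hjv : j ∉ v := fun h => hj (Finset.mem_powerset.1 hv h)
      rw [Finset.card_insert_of_notMem hjv, Finset.piecewise_insert]
      have : Function.update (v.piecewise b a) j (a j) = v.piecewise b a := by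
        rw [Function.update_eq_self_iff, Finset.piecewise_eq_of_notMem _ _ _ hjv]
      rw [this]
      ring
    · ring

/-! ### Fourier coefficients of functions with bounded mixed differences. -/

/-- Rounding down to the grid of step width `1 / N`. -/
noncomputable def gridFloor (N : ℕ) (t : ℝ) : ℝ := (⌊(N : ℝ) * t⌋ : ℝ) / N

theorem measurable_gridFloor (N : ℕ) : Measurable (gridFloor N) := by
  unfold gridFloor
  fun_prop

theorem abs_sub_gridFloor_le {N : ℕ} (hN : N ≠ 0) (t : ℝ) : |t - gridFloor N t| ≤ 1 / N := by
  have hN' : (0 : ℝ) < N := by positivity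
  unfold gridFloor
  have h1 := Int.floor_le ((N : ℝ) * t)
  have h2 := Int.lt_floor_add_one ((N : ℝ) * t)
  rw [abs_le]
  constructor
  · have : (⌊(N : ℝ) * t⌋ : ℝ) / N ≤ t := by
      rw [div_le_iff₀ hN']; linarith
    have : 0 ≤ 1 / (N : ℝ) := by positivity
    linarith
  · rw [sub_le_iff_le_add, ← add_div, le_div_iff₀ hN']
    linarith

theorem gridFloor_mem_Icc {N : ℕ} (hN : N ≠ 0) {t : ℝ} (ht : t ∈ Set.Icc (0 : ℝ) 1) :
    gridFloor N t ∈ Set.Icc (0 : ℝ) 1 := by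
  have hN' : (0 : ℝ) < N := by positivity
  unfold gridFloor
  constructor
  · have : 0 ≤ ⌊(N : ℝ) * t⌋ := Int.floor_nonneg.2 (mul_nonneg hN'.le ht.1)
    exact div_nonneg (by exact_mod_cast this) hN'.le
  · rw [div_le_one hN']
    exact (Int.floor_le _).trans (mul_le_of_le_one_right hN'.le ht.2)

theorem integral_fourier_cell_eq_zero {h : ℤ} (h0 : h ≠ 0) (a : ℝ) :
    ∫ t in a..(a + 1 / (h.natAbs : ℝ)), fourier (-h) (t : UnitAddCircle) = 0 := by
  have hc : (2 * Real.pi * Complex.I * ((-h : ℤ) : ℂ)) ≠ 0 := by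
    refine mul_ne_zero Complex.two_pi_I_ne_zero ?_
    exact_mod_cast neg_ne_zero.2 h0
  simp only [fourier_coe_apply, Complex.ofReal_one, div_one]
  rw [integral_exp_mul_complex hc, div_eq_zero_iff]
  left
  rw [sub_eq_zero, Complex.exp_eq_exp_iff_exists_int]
  have hN : (h.natAbs : ℂ) ≠ 0 := by exact_mod_cast Int.natAbs_ne_zero.2 h0
  rcases Int.natAbs_eq h with hh | hh
  · refine ⟨-1, ?_⟩
    have : (h : ℂ) = (h.natAbs : ℂ) := by
      conv_lhs => rw [hh]
      rw [Int.cast_natCast]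
    push_cast
    rw [this]
    field_simp
    ring
  · refine ⟨1, ?_⟩
    have : (h : ℂ) = -(h.natAbs : ℂ) := by
      conv_lhs => rw [hh]
      rw [Int.cast_neg, Int.cast_natCast]
    push_cast
    rw [this]
    field_simp

/-- The function `φ` is constant on each cell of length `1/|h|`, which is a full period of the
exponential. -/
theorem integral_fourier_mul_eq_zero_of_floor {h : ℤ} (h0 : h ≠ 0) {φ : ℝ → ℂ}
    (hφ : ∀ t t', gridFloor h.natAbs t = gridFloor h.natAbs t' → φ t = φ t') :
    ∫ t in Set.Ioc (0 : ℝ) 1, fourier (-h) (t : UnitAddCircle) * φ t = 0 := by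
  set N := h.natAbs
  have hN : N ≠ 0 := Int.natAbs_ne_zero.2 h0
  have hN' : (0 : ℝ) < N := by positivity
  have hle : ∀ m : ℕ, (m : ℝ) / N ≤ ((m + 1 : ℕ) : ℝ) / N := fun m => by
    push_cast; gcongr; linarith
  have hcell : ∀ (m : ℕ), ∀ t ∈ Set.Ioo ((m : ℝ) / N) (((m + 1 : ℕ) : ℝ) / N),
      φ t = φ ((m : ℝ) / N) := by
    intro m t ht
    refine hφ _ _ ?_
    unfold gridFloor
    congr 2
    rw [mul_div_cancel₀ _ hN'.ne', Int.floor_natCast, Int.floor_eq_iff]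
    have h1 := (div_lt_iff₀ hN').1 ht.1
    have h2 := (lt_div_iff₀ hN').1 ht.2
    push_cast at h2 ⊢
    constructor <;> linarith
  have hcont : Continuous fun t : ℝ => fourier (-h) (t : UnitAddCircle) :=
    (fourier (-h)).continuous.comp (AddCircle.continuous_mk' 1)
  have hint : ∀ m < N, IntervalIntegrable
      (fun t : ℝ => fourier (-h) (t : UnitAddCircle) * φ t) volume ((m : ℝ) / N)
      (((m + 1 : ℕ) : ℝ) / N) := by
    intro m _
    rw [intervalIntegrable_iff_integrableOn_Ioo_of_le (hle m)]
    have hc : IntegrableOn (fun t : ℝ => fourier (-h) (t : UnitAddCircle) * φ ((m : ℝ) / N))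
        (Set.Ioo ((m : ℝ) / N) (((m + 1 : ℕ) : ℝ) / N)) :=
      ((hcont.mul continuous_const).integrableOn_Icc).mono_set Set.Ioo_subset_Icc_self
    exact hc.congr_fun (fun t ht => by simp only [hcell m t ht]) measurableSet_Ioo
  have hsum := intervalIntegral.sum_integral_adjacent_intervals hint
  rw [← intervalIntegral.integral_of_le zero_le_one]
  simp only [Nat.cast_zero, zero_div, div_self hN'.ne'] at hsum
  rw [← hsum]
  refine Finset.sum_eq_zero fun m _ => ?_
  rw [intervalIntegral.integral_of_le (hle m), integral_Ioc_eq_integral_Ioo,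
    setIntegral_congr_fun measurableSet_Ioo
      (fun t ht => by simp only [hcell m t ht] :
        Set.EqOn _ (fun t : ℝ => fourier (-h) (t : UnitAddCircle) * φ ((m : ℝ) / N)) _),
    ← integral_Ioc_eq_integral_Ioo, ← intervalIntegral.integral_of_le (hle m),
    intervalIntegral.integral_mul_const]
  have hend : ((m + 1 : ℕ) : ℝ) / N = (m : ℝ) / N + 1 / N := by push_cast; ring
  rw [hend, integral_fourier_cell_eq_zero h0, zero_mul]

/-- The uniform law on the half-open unit cube. -/
noncomputable def unitCubeMeasure (k : ℕ) : Measure (Fin k → ℝ) :=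
  Measure.pi fun _ => (volume : Measure ℝ).restrict (Set.Ioc 0 1)

instance : IsProbabilityMeasure ((volume : Measure ℝ).restrict (Set.Ioc 0 1)) :=
  ⟨by simp⟩

instance (k : ℕ) : IsProbabilityMeasure (unitCubeMeasure k) := by
  unfold unitCubeMeasure; infer_instance

theorem ae_mem_unitCube (k : ℕ) :
    ∀ᵐ x ∂unitCubeMeasure k, ∀ i, x i ∈ Set.Icc (0 : ℝ) 1 := by
  rw [MeasureTheory.ae_all_iff]
  intro i
  have h : ∀ᵐ t ∂(volume : Measure ℝ).restrict (Set.Ioc 0 1), t ∈ Set.Icc (0 : ℝ) 1 :=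
    (ae_restrict_mem measurableSet_Ioc).mono fun t ht => Set.Ioc_subset_Icc_self ht
  exact (measurePreserving_eval (fun _ : Fin k => (volume : Measure ℝ).restrict (Set.Ioc 0 1))
    i).quasiMeasurePreserving.ae h

/-- By Fubini, coordinate `j` is integrated first, where the one-dimensional cancellation applies.
-/
theorem integral_fourier_mul_pi_eq_zero {k : ℕ} (j : Fin k) {h : ℤ} (h0 : h ≠ 0)
    {H : (Fin k → ℝ) → ℂ} (hH : Integrable H (unitCubeMeasure k))
    (hfl : ∀ x t t', gridFloor h.natAbs t = gridFloor h.natAbs t' →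
      H (Function.update x j t) = H (Function.update x j t')) :
    ∫ x, fourier (-h) ((x j : ℝ) : UnitAddCircle) * H x ∂unitCubeMeasure k = 0 := by
  obtain _ | k := k
  · exact j.elim0
  have hcont : Continuous fun t : ℝ => fourier (-h) (t : UnitAddCircle) :=
    (fourier (-h)).continuous.comp (AddCircle.continuous_mk' 1)
  have hint : Integrable (fun x : Fin (k + 1) → ℝ =>
      fourier (-h) ((x j : ℝ) : UnitAddCircle) * H x) (unitCubeMeasure (k + 1)) := by
    refine hH.bdd_mul (c := 1) ?_ ?_
    · exact (hcont.comp (continuous_apply j)).aestronglyMeasurable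
    · exact Filter.Eventually.of_forall fun x => by
        rw [fourier_apply, Circle.norm_coe]
  have hmp := (measurePreserving_piFinSuccAbove
    (fun _ : Fin (k + 1) => (volume : Measure ℝ).restrict (Set.Ioc 0 1)) j).symm
  unfold unitCubeMeasure at hint ⊢
  rw [← hmp.integral_comp']
  have hint2 := (hmp.integrable_comp_emb (MeasurableEquiv.measurableEmbedding _)).2 hint
  refine (integral_prod_symm _ hint2).trans ?_
  refine integral_eq_zero_of_ae (Filter.Eventually.of_forall fun y => ?_)
  have := integral_fourier_mul_eq_zero_of_floor h0
    (φ := fun t => H (j.insertNth t y)) fun t t' htt' => by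
      have := hfl (j.insertNth 0 y) t t' htt'
      simpa using this
  simpa [MeasurableEquiv.piFinSuccAbove, Fin.insertNthEquiv] using this

/-- Fourier coefficients over the unit cube of functions with bounded mixed differences. -/
theorem norm_integral_mFourier_mul_le {k : ℕ} {F : (Fin k → ℝ) → ℂ} (hF : Measurable F)
    {M L : ℝ} (hM : 0 ≤ M) (hL : 0 ≤ L)
    (hdiff : ∀ (u : Finset (Fin k)) (a b : Fin k → ℝ), (∀ i, a i ∈ Set.Icc (0 : ℝ) 1) →
      (∀ i, b i ∈ Set.Icc (0 : ℝ) 1) →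
      ‖∑ v ∈ u.powerset, (-1 : ℂ) ^ #v * F (v.piecewise b a)‖ ≤
        M * ∏ j ∈ u, (L * |a j - b j|)) (h : Fin k → ℤ) :
    ‖∫ x, UnitAddTorus.mFourier (-h) (fun i => ((x i : ℝ) : UnitAddCircle)) * F x
      ∂unitCubeMeasure k‖ ≤ M * ∏ j ∈ freqSupport h, (L / (h j).natAbs) := by
  set u := freqSupport h
  have hu : ∀ {j}, j ∈ u ↔ h j ≠ 0 := fun {j} => by simp [u, freqSupport]
  have hcube : ∀ᵐ x ∂unitCubeMeasure k, ∀ i, x i ∈ Set.Icc (0 : ℝ) 1 := ae_mem_unitCube k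
  let fl : (Fin k → ℝ) → Fin k → ℝ := fun x i => gridFloor (h i).natAbs (x i)
  let E : (Fin k → ℝ) → ℂ := fun x =>
    UnitAddTorus.mFourier (-h) (fun i => ((x i : ℝ) : UnitAddCircle))
  have hEcont : Continuous E := (UnitAddTorus.mFourier (-h)).continuous.comp
    (continuous_pi fun i => (AddCircle.continuous_mk' 1).comp (continuous_apply i))
  have hEnorm : ∀ x, ‖E x‖ ≤ 1 := fun x =>
    ((UnitAddTorus.mFourier (-h)).norm_coe_le_norm _).trans_eq UnitAddTorus.mFourier_norm
  have hflm : ∀ v : Finset (Fin k), Measurable fun x : Fin k → ℝ => v.piecewise (fl x) x := by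
    intro v
    refine measurable_pi_lambda _ fun i => ?_
    by_cases hi : i ∈ v
    · simp only [Finset.piecewise_eq_of_mem _ _ _ hi]
      exact (measurable_gridFloor _).comp (measurable_pi_apply i)
    · simp only [Finset.piecewise_eq_of_notMem _ _ _ hi]
      exact measurable_pi_apply i
  have hFb : ∀ x : Fin k → ℝ, (∀ i, x i ∈ Set.Icc (0 : ℝ) 1) → ‖F x‖ ≤ M := fun x hx => by
    simpa using hdiff ∅ x x hx hx
  have hint : ∀ v ⊆ u, Integrable (fun x => F (v.piecewise (fl x) x)) (unitCubeMeasure k) := by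
    intro v hv
    refine Integrable.of_bound (hF.comp (hflm v)).aestronglyMeasurable M ?_
    filter_upwards [hcube] with x hx
    refine hFb _ fun i => ?_
    by_cases hi : i ∈ v
    · rw [Finset.piecewise_eq_of_mem _ _ _ hi]
      exact gridFloor_mem_Icc (Int.natAbs_ne_zero.2 (hu.1 (hv hi))) (hx i)
    · rw [Finset.piecewise_eq_of_notMem _ _ _ hi]
      exact hx i
  have hintE : ∀ v ⊆ u,
      Integrable (fun x => E x * F (v.piecewise (fl x) x)) (unitCubeMeasure k) := fun v hv =>
    (hint v hv).bdd_mul (c := 1) hEcont.aestronglyMeasurable (Filter.Eventually.of_forall hEnorm)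
  -- For `j ∈ v` the rounded function depends on `x j` only through its cell of width `1/|h j|`, and
  -- so do the remaining characters, which are free of `x j`.
  have hzero : ∀ v ⊆ u, v ≠ ∅ → ∫ x, E x * F (v.piecewise (fl x) x) ∂unitCubeMeasure k = 0 := by
    intro v hv hne
    obtain ⟨j, hj⟩ := Finset.nonempty_iff_ne_empty.2 hne
    let E' : (Fin k → ℝ) → ℂ := fun x =>
      ∏ i ∈ Finset.univ.erase j, fourier (-h i) ((x i : ℝ) : UnitAddCircle)
    have hE : ∀ x, E x = fourier (-h j) ((x j : ℝ) : UnitAddCircle) * E' x := fun x =>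
      (Finset.mul_prod_erase _ (fun i => fourier (-h i) ((x i : ℝ) : UnitAddCircle))
        (Finset.mem_univ j)).symm
    have hE'cont : Continuous E' := continuous_finsetProd _ fun i _ =>
      (fourier (-h i)).continuous.comp ((AddCircle.continuous_mk' 1).comp (continuous_apply i))
    simp only [hE, mul_assoc]
    refine integral_fourier_mul_pi_eq_zero j (hu.1 (hv hj)) ?_ ?_
    · refine (hint v hv).bdd_mul (c := 1) hE'cont.aestronglyMeasurable
        (Filter.Eventually.of_forall fun x => ?_)
      simp only [E', norm_prod, fourier_apply, Circle.norm_coe, Finset.prod_const_one, le_refl]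
    · intro x t t' htt'
      congr 1
      · refine Finset.prod_congr rfl fun i hi => ?_
        rw [Function.update_of_ne (Finset.ne_of_mem_erase hi),
          Function.update_of_ne (Finset.ne_of_mem_erase hi)]
      · congr 1
        funext i
        by_cases hij : i = j
        · subst hij
          simp [Finset.piecewise_eq_of_mem _ _ _ hj, fl, htt']
        · by_cases hi : i ∈ v
          · simp [Finset.piecewise_eq_of_mem _ _ _ hi, fl, Function.update_of_ne hij]
          · simp [Finset.piecewise_eq_of_notMem _ _ _ hi, Function.update_of_ne hij]
  -- Only `v = ∅` contributes to the right side, so `F` may be replaced by its mixed difference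
  -- between `x` and the rounded point, whose increments are at most `1/|h j|`.
  have hmain : ∫ x, E x * F x ∂unitCubeMeasure k =
      ∫ x, E x * ∑ v ∈ u.powerset, (-1 : ℂ) ^ #v * F (v.piecewise (fl x) x)
        ∂unitCubeMeasure k := by
    simp only [Finset.mul_sum, mul_left_comm (E _)]
    rw [integral_finsetSum _ fun v hv => (hintE v (Finset.mem_powerset.1 hv)).const_mul _]
    simp only [integral_const_mul]
    rw [Finset.sum_eq_single_of_mem ∅ (Finset.empty_mem_powerset u)]
    · simp
    · intro v hv hne
      rw [hzero v (Finset.mem_powerset.1 hv) hne, mul_zero]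
  change ‖∫ x, E x * F x ∂unitCubeMeasure k‖ ≤ _
  rw [hmain]
  refine (norm_integral_le_of_norm_le_const (C := M * ∏ j ∈ u, (L / (h j).natAbs)) ?_).trans_eq
    (by simp)
  filter_upwards [hcube] with x hx
  rw [norm_mul]
  let b : Fin k → ℝ := u.piecewise (fl x) x
  have hb : ∀ i, b i ∈ Set.Icc (0 : ℝ) 1 := by
    intro i
    by_cases hi : i ∈ u
    · simp only [b, Finset.piecewise_eq_of_mem _ _ _ hi]
      exact gridFloor_mem_Icc (Int.natAbs_ne_zero.2 (hu.1 hi)) (hx i)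
    · simp only [b, Finset.piecewise_eq_of_notMem _ _ _ hi]
      exact hx i
  have hsame : ∀ v ∈ u.powerset, v.piecewise (fl x) x = v.piecewise b x := by
    intro v hv
    funext i
    by_cases hi : i ∈ v
    · simp only [Finset.piecewise_eq_of_mem _ _ _ hi, b,
        Finset.piecewise_eq_of_mem _ _ _ (Finset.mem_powerset.1 hv hi)]
    · simp only [Finset.piecewise_eq_of_notMem _ _ _ hi]
  rw [Finset.sum_congr rfl fun v hv => by rw [hsame v hv]]
  refine (mul_le_of_le_one_left (norm_nonneg _) (hEnorm x)).trans ((hdiff u x b hx hb).trans ?_)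
  refine mul_le_mul_of_nonneg_left (Finset.prod_le_prod
    (fun j _ => mul_nonneg hL (abs_nonneg _)) fun j hj => ?_) hM
  rw [div_eq_mul_one_div]
  refine mul_le_mul_of_nonneg_left ?_ hL
  simp only [b, Finset.piecewise_eq_of_mem _ _ _ hj]
  exact abs_sub_gridFloor_le (Int.natAbs_ne_zero.2 (hu.1 hj)) _

/-! ### Parseval on the torus and the mean square error of one random shift. -/

section Torus

attribute [local instance] instMeasureSpaceUnitAddCircle
  instIsAddHaarMeasureUnitAddCircleVolume instIsProbabilityMeasureUnitAddCircleVolume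

theorem restrict_volume_Ioc_eq_unitCubeMeasure (k : ℕ) :
    (volume : Measure (Fin k → ℝ)).restrict {x | ∀ i, x i ∈ Set.Ioc (0 : ℝ) (0 + 1)} =
      unitCubeMeasure k := by
  have : {x : Fin k → ℝ | ∀ i, x i ∈ Set.Ioc (0 : ℝ) (0 + 1)} =
      Set.univ.pi fun _ => Set.Ioc (0 : ℝ) 1 := by
    ext x; simp
  rw [this, volume_pi, Measure.restrict_pi_pi]
  rfl

theorem integral_torus_eq {k : ℕ} {E : Type*} [NormedAddCommGroup E] [NormedSpace ℝ E]
    (f : UnitAddTorus (Fin k) → E) :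
    ∫ y, f y = ∫ x, f (fun i => (x i : UnitAddCircle)) ∂unitCubeMeasure k := by
  rw [← restrict_volume_Ioc_eq_unitCubeMeasure]
  exact UnitAddTorus.integral_preimage f fun _ => 0

theorem integral_unitCube_comp_add {k : ℕ} {E : Type*} [NormedAddCommGroup E] [NormedSpace ℝ E]
    (f : UnitAddTorus (Fin k) → E) (t : UnitAddTorus (Fin k)) :
    ∫ x, f ((fun i => ((x i : ℝ) : UnitAddCircle)) + t) ∂unitCubeMeasure k =
      ∫ x, f (fun i => (x i : UnitAddCircle)) ∂unitCubeMeasure k := by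
  rw [← integral_torus_eq, ← integral_torus_eq fun y => f (y + t)]
  exact integral_add_right_eq_self f t

/-- Parseval's identity for bounded functions on the torus, with integrals over the unit cube. -/
theorem hasSum_sq_norm_integral_mFourier {k : ℕ} {f : UnitAddTorus (Fin k) → ℂ}
    (hf : Measurable f) {c : ℝ} (hc : ∀ y, ‖f y‖ ≤ c) :
    HasSum (fun h : Fin k → ℤ => ‖∫ x, UnitAddTorus.mFourier (-h)
        (fun i => ((x i : ℝ) : UnitAddCircle)) * f (fun i => (x i : UnitAddCircle))
        ∂unitCubeMeasure k‖ ^ 2)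
      (∫ x, ‖f (fun i => (x i : UnitAddCircle))‖ ^ 2 ∂unitCubeMeasure k) := by
  have hmem : MemLp f 2 (volume : Measure (UnitAddTorus (Fin k))) :=
    MemLp.of_bound hf.aestronglyMeasurable c (Filter.Eventually.of_forall hc)
  have h := UnitAddTorus.hasSum_sq_mFourierCoeff hmem.toLp
  have hae := hmem.coeFn_toLp
  have h1 : ∫ y, ‖hmem.toLp f y‖ ^ 2 = ∫ y, ‖f y‖ ^ 2 :=
    integral_congr_ae (hae.mono fun y hy => by simp only [hy])
  have h2 : ∀ n, UnitAddTorus.mFourierCoeff (hmem.toLp f) n =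
      ∫ y, UnitAddTorus.mFourier (-n) y * f y := fun n =>
    integral_congr_ae (hae.mono fun y hy => by simp only [hy, smul_eq_mul])
  rw [h1] at h
  simp only [h2] at h
  rw [integral_torus_eq] at h
  refine h.congr_fun fun n => ?_
  rw [integral_torus_eq]

end Torus

/-- The integral factors over the coordinates, and any `j` with `h j ≠ 0` gives a vanishing factor.
-/
theorem integral_mFourier_neg_eq_zero {k : ℕ} {h : Fin k → ℤ} (h0 : h ≠ 0) :
    ∫ x, UnitAddTorus.mFourier (-h) (fun i => ((x i : ℝ) : UnitAddCircle)) ∂unitCubeMeasure k =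
      0 := by
  obtain ⟨j, hj⟩ := Function.ne_iff.1 h0
  have := integral_fintype_prod_eq_prod (𝕜 := ℂ)
    (μ := fun _ : Fin k => (volume : Measure ℝ).restrict (Set.Ioc 0 1))
    (fun i (t : ℝ) => fourier (-h i) (t : UnitAddCircle))
  refine this.trans (Finset.prod_eq_zero (Finset.mem_univ j) ?_)
  simpa using integral_fourier_mul_eq_zero_of_floor hj (φ := fun _ => 1) fun _ _ _ => rfl

theorem sq_div_natAbs_eq {L : ℝ} {h : ℤ} (h0 : h ≠ 0) :
    (L / h.natAbs) ^ 2 = 2 * Real.pi ^ 2 * L ^ 2 * decay h := by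
  have h1 : (h : ℝ) ≠ 0 := by exact_mod_cast h0
  have habs : (h.natAbs : ℝ) = |(h : ℝ)| := by rw [Nat.cast_natAbs, Int.cast_abs]
  rw [decay, if_neg h0, div_pow, habs, sq_abs]
  field_simp

/-- The mean square error of a shifted lattice rule for functions with bounded mixed
differences. -/
theorem integral_sq_norm_lattice_error_le {k n : ℕ} (hn : n ≠ 0) (z : Fin k → ℕ)
    {F : (Fin k → ℝ) → ℂ} (hF : Measurable F) {M L : ℝ} (hM : 0 ≤ M) (hL : 0 ≤ L)
    (hdiff : ∀ (u : Finset (Fin k)) (a b : Fin k → ℝ), (∀ i, a i ∈ Set.Icc (0 : ℝ) 1) →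
      (∀ i, b i ∈ Set.Icc (0 : ℝ) 1) →
      ‖∑ v ∈ u.powerset, (-1 : ℂ) ^ #v * F (v.piecewise b a)‖ ≤
        M * ∏ j ∈ u, (L * |a j - b j|)) :
    ∫ Δ, ‖∫ x, F x ∂unitCubeMeasure k - (1 / (n : ℂ)) * ∑ i ∈ Finset.Icc 1 n,
        F (fun j => Int.fract (latticePoint n z i j + Δ j))‖ ^ 2 ∂unitCubeMeasure k ≤
      ∑ u : Finset (Fin k) with u.Nonempty,
        M ^ 2 * (2 * Real.pi ^ 2 * L ^ 2) ^ #u * latticeSum n z u := by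
  have hnC : (n : ℂ) ≠ 0 := by exact_mod_cast hn
  set I : ℂ := ∫ x, F x ∂unitCubeMeasure k
  -- `F` need not be periodic. Through representatives in `[0, 1)^k` it becomes a bounded measurable
  -- function on the torus, which is enough for Parseval.
  let rep : UnitAddTorus (Fin k) → Fin k → ℝ := fun y j => (AddCircle.equivIco (1 : ℝ) 0 (y j) : ℝ)
  let f : UnitAddTorus (Fin k) → ℂ := fun y => F (rep y)
  let t : ℕ → UnitAddTorus (Fin k) := fun i j => ((latticePoint n z i j : ℝ) : UnitAddCircle)
  let coe : (Fin k → ℝ) → UnitAddTorus (Fin k) := fun x i => (x i : UnitAddCircle)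
  have hrepm : Measurable rep := measurable_pi_lambda _ fun j =>
    (measurable_subtype_coe.comp (AddCircle.measurableEquivIco 1 0).measurable).comp
      (measurable_pi_apply j)
  have hrep : ∀ y j, rep y j ∈ Set.Icc (0 : ℝ) 1 := fun y j => by
    have := (AddCircle.equivIco (1 : ℝ) 0 (y j)).2
    exact ⟨this.1, by simpa using this.2.le⟩
  have hrepcoe : ∀ x, rep (coe x) = fun j => Int.fract (x j) := fun x => by
    funext j
    simp only [rep, coe, AddCircle.coe_equivIco_mk_apply, div_one, mul_one]
  have hfm : Measurable f := hF.comp hrepm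
  have hFb : ∀ x : Fin k → ℝ, (∀ i, x i ∈ Set.Icc (0 : ℝ) 1) → ‖F x‖ ≤ M := fun x hx => by
    simpa using hdiff ∅ x x hx hx
  have hfb : ∀ y, ‖f y‖ ≤ M := fun y => hFb _ (hrep y)
  let g : UnitAddTorus (Fin k) → ℂ := fun y =>
    I - (1 / (n : ℂ)) * ∑ i ∈ Finset.Icc 1 n, f (y + t i)
  have hgm : Measurable g := by
    refine measurable_const.sub (measurable_const.mul
      (Finset.measurable_sum _ fun i _ => hfm.comp (measurable_add_const (t i))))
  have hgb : ∀ y, ‖g y‖ ≤ ‖I‖ + ‖1 / (n : ℂ)‖ * ∑ i ∈ Finset.Icc 1 n, M := fun y => by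
    refine (norm_sub_le _ _).trans (add_le_add le_rfl ?_)
    rw [norm_mul]
    exact mul_le_mul_of_nonneg_left
      ((norm_sum_le _ _).trans (Finset.sum_le_sum fun i _ => hfb _)) (norm_nonneg _)
  have hcoem : Continuous coe := continuous_pi fun i =>
    (AddCircle.continuous_mk' 1).comp (continuous_apply i)
  have hgcoe : ∀ Δ, g (coe Δ) = I - (1 / (n : ℂ)) * ∑ i ∈ Finset.Icc 1 n,
      F (fun j => Int.fract (latticePoint n z i j + Δ j)) := by
    intro Δ
    simp only [g, f]
    congr 2
    refine Finset.sum_congr rfl fun i _ => ?_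
    have : coe Δ + t i = coe fun j => latticePoint n z i j + Δ j := by
      funext j
      simp only [coe, t, Pi.add_apply, AddCircle.coe_add, add_comm]
    rw [this, hrepcoe]
  -- The measure lives on `(0, 1]^k` while representatives lie in `[0, 1)^k`; the two cubes differ
  -- by a null set.
  have hae : ∀ᵐ x ∂unitCubeMeasure k, rep (coe x) = x := by
    unfold unitCubeMeasure
    have h1 : ∀ᵐ s ∂(volume : Measure ℝ).restrict (Set.Ioc 0 1), Int.fract s = s := by
      rw [← restrict_Ico_eq_restrict_Ioc]
      exact (ae_restrict_mem measurableSet_Ico).mono fun s hs => Int.fract_eq_self.2 hs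
    have h2 : ∀ᵐ x ∂(Measure.pi fun _ : Fin k => (volume : Measure ℝ).restrict (Set.Ioc 0 1)),
        ∀ i, Int.fract (x i) = x i := by
      rw [MeasureTheory.ae_all_iff]
      exact fun i => (measurePreserving_eval
        (fun _ : Fin k => (volume : Measure ℝ).restrict (Set.Ioc 0 1))
        i).quasiMeasurePreserving.ae h1
    exact h2.mono fun x hx => by rw [hrepcoe]; exact funext hx
  let c : (Fin k → ℤ) → ℂ := fun h => ∫ x, UnitAddTorus.mFourier (-h) (coe x) * F x
    ∂unitCubeMeasure k
  have hEcont : ∀ h : Fin k → ℤ, Continuous fun x => UnitAddTorus.mFourier h (coe x) := fun h =>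
    (UnitAddTorus.mFourier h).continuous.comp hcoem
  have hEnorm : ∀ (h : Fin k → ℤ) y, ‖UnitAddTorus.mFourier h y‖ ≤ 1 := fun h y =>
    ((UnitAddTorus.mFourier h).norm_coe_le_norm _).trans_eq UnitAddTorus.mFourier_norm
  have hfint : ∀ i, Integrable (fun x => f (coe x + t i)) (unitCubeMeasure k) := fun i =>
    Integrable.of_bound ((hfm.comp (measurable_add_const (t i))).comp
      hcoem.measurable).aestronglyMeasurable M (Filter.Eventually.of_forall fun x => hfb _)
  have hEint : ∀ (h : Fin k → ℤ) {G : (Fin k → ℝ) → ℂ}, Integrable G (unitCubeMeasure k) →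
      Integrable (fun x => UnitAddTorus.mFourier h (coe x) * G x) (unitCubeMeasure k) :=
    fun h G hG => hG.bdd_mul (c := 1) (hEcont h).aestronglyMeasurable
      (Filter.Eventually.of_forall fun x => hEnorm h _)
  have hshift : ∀ (h : Fin k → ℤ) i,
      ∫ x, UnitAddTorus.mFourier (-h) (coe x) * f (coe x + t i) ∂unitCubeMeasure k =
        UnitAddTorus.mFourier h (t i) * c h := by
    intro h i
    have h1 := integral_unitCube_comp_add (fun y => UnitAddTorus.mFourier (-h) y * f y) (t i)
    have hadd : ∀ x y : UnitAddTorus (Fin k), UnitAddTorus.mFourier (-h) (x + y) =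
        UnitAddTorus.mFourier (-h) x * UnitAddTorus.mFourier (-h) y := by
      intro x y
      simp only [UnitAddTorus.mFourier, ContinuousMap.coe_mk, ← Finset.prod_mul_distrib]
      refine Finset.prod_congr rfl fun j _ => ?_
      simp only [fourier_apply, Pi.add_apply, smul_add, AddCircle.toCircle_add, Circle.coe_mul]
    have hone : UnitAddTorus.mFourier h (t i) * UnitAddTorus.mFourier (-h) (t i) = 1 := by
      rw [← UnitAddTorus.mFourier_add, add_neg_cancel, UnitAddTorus.mFourier_zero]
      rfl
    have h2 : ∫ x, UnitAddTorus.mFourier (-h) (coe x) * f (coe x) ∂unitCubeMeasure k = c h :=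
      integral_congr_ae (hae.mono fun x hx => by simp only [f, hx])
    rw [← h2, ← h1, ← integral_const_mul]
    refine integral_congr_ae (Filter.Eventually.of_forall fun x => ?_)
    simp only [hadd]
    linear_combination (-(UnitAddTorus.mFourier (-h) (coe x) * f (coe x + t i))) * hone
  -- A translation multiplies the coefficient by a character value, and averaging these over the
  -- lattice points leaves only the dual lattice. At `h = 0` the exact integral cancels.
  have hcoeff : ∀ h : Fin k → ℤ,
      ∫ x, UnitAddTorus.mFourier (-h) (coe x) * g (coe x) ∂unitCubeMeasure k =
        if h = 0 then 0 else -((if (n : ℤ) ∣ ∑ j, h j * (z j : ℤ) then 1 else 0) * c h) := by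
    intro h
    have h1 : ∫ x, UnitAddTorus.mFourier (-h) (coe x) * g (coe x) ∂unitCubeMeasure k =
        I * (∫ x, UnitAddTorus.mFourier (-h) (coe x) ∂unitCubeMeasure k) -
          (if (n : ℤ) ∣ ∑ j, h j * (z j : ℤ) then 1 else 0) * c h := by
      have hexp : ∀ x, UnitAddTorus.mFourier (-h) (coe x) * g (coe x) =
          I * UnitAddTorus.mFourier (-h) (coe x) - (1 / (n : ℂ)) * ∑ i ∈ Finset.Icc 1 n,
            UnitAddTorus.mFourier (-h) (coe x) * f (coe x + t i) := by
        intro x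
        simp only [g, ← Finset.mul_sum]
        ring
      simp only [hexp]
      rw [integral_sub, integral_const_mul, integral_const_mul,
        integral_finsetSum _ fun i _ => hEint (-h) (hfint i)]
      · simp only [hshift, ← Finset.sum_mul]
        rw [← average_mFourier_latticePoint hn, mul_assoc]
      · simpa [mul_comm] using hEint (-h) (integrable_const I)
      · exact (integrable_finsetSum _ fun i _ => hEint (-h) (hfint i)).const_mul _
    rw [h1]
    by_cases h0 : h = 0
    · subst h0
      have hc0 : c 0 = I := by
        simp only [c, I, neg_zero, UnitAddTorus.mFourier_zero, ContinuousMap.one_apply, one_mul]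
      rw [hc0]
      simp [UnitAddTorus.mFourier_zero]
    · rw [integral_mFourier_neg_eq_zero h0, if_neg h0]
      ring
  have hpars := hasSum_sq_norm_integral_mFourier hgm hgb
  have hbound := hasSum_sum (s := Finset.univ.filter fun u : Finset (Fin k) => u.Nonempty)
    fun u _ => (hasSum_latticeSum hn z u).mul_left (M ^ 2 * (2 * Real.pi ^ 2 * L ^ 2) ^ #u)
  change HasSum (fun h : Fin k → ℤ =>
    ‖∫ x, UnitAddTorus.mFourier (-h) (coe x) * g (coe x) ∂unitCubeMeasure k‖ ^ 2)
    (∫ x, ‖g (coe x)‖ ^ 2 ∂unitCubeMeasure k) at hpars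
  simp only [hgcoe] at hpars
  simp only [← hgcoe, hcoeff] at hpars
  simp only [hgcoe] at hpars
  refine hasSum_le (fun h => ?_) hpars hbound
  have hnonneg : ∀ u : Finset (Fin k), 0 ≤ M ^ 2 * (2 * Real.pi ^ 2 * L ^ 2) ^ #u *
      (if freqSupport h = u ∧ (n : ℤ) ∣ ∑ j, h j * (z j : ℤ) then ∏ j, decay (h j) else 0) := by
    intro u
    refine mul_nonneg (by positivity) ?_
    split_ifs
    · exact Finset.prod_nonneg fun j _ => (decay_pos _).le
    · exact le_rfl
  by_cases h0 : h = 0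
  · simp only [h0, if_true, norm_zero]
    rw [h0] at hnonneg
    simpa using Finset.sum_nonneg fun u (_ : u ∈ Finset.univ.filter fun u : Finset (Fin k) =>
      u.Nonempty) => hnonneg u
  by_cases hd : (n : ℤ) ∣ ∑ j, h j * (z j : ℤ)
  · have hsupp : (freqSupport h).Nonempty := by
      obtain ⟨j, hj⟩ := Function.ne_iff.1 h0
      exact ⟨j, by simpa [freqSupport] using hj⟩
    -- On the right, `h` contributes only to `u = freqSupport h`.
    refine le_trans ?_ (Finset.single_le_sum (fun u _ => hnonneg u)
      (Finset.mem_filter.2 ⟨Finset.mem_univ (freqSupport h), hsupp⟩))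
    simp only [h0, hd, if_true, if_false, one_mul, norm_neg, and_self]
    have hc := norm_integral_mFourier_mul_le hF hM hL hdiff h
    refine (pow_le_pow_left₀ (norm_nonneg _) hc 2).trans_eq ?_
    rw [mul_pow, ← Finset.prod_pow, mul_assoc, ← Finset.prod_const]
    congr 1
    have hdec : ∏ j, decay (h j) = ∏ j ∈ freqSupport h, decay (h j) := by
      symm
      refine Finset.prod_subset (Finset.subset_univ _) fun j _ hj => ?_
      have : h j = 0 := by simpa [freqSupport] using hj
      simp [this, decay]
    rw [hdec, ← Finset.prod_mul_distrib]
    refine Finset.prod_congr rfl fun j hj => ?_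
    exact sq_div_natAbs_eq (by simpa [freqSupport] using hj)
  · simp only [h0, hd, if_false, zero_mul, neg_zero, norm_zero]
    simp

/-! ### Rescaling to the data cube and averaging over several shifts. -/

theorem restrict_Icc_eq_unitCubeMeasure (k : ℕ) :
    (volume : Measure (Fin k → ℝ)).restrict (Set.Icc (fun _ => 0) (fun _ => 1)) =
      unitCubeMeasure k := by
  rw [← Set.pi_univ_Icc, volume_pi, Measure.restrict_pi_pi]
  unfold unitCubeMeasure
  congr 1
  funext i
  exact Measure.restrict_congr_set Ioc_ae_eq_Icc.symm

theorem shiftLaw_eq (k R : ℕ) : shiftLaw k R = Measure.pi fun _ : Fin R => unitCubeMeasure k := by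
  unfold shiftLaw
  rw [restrict_Icc_eq_unitCubeMeasure]

instance (k R : ℕ) : IsProbabilityMeasure (shiftLaw k R) := by
  rw [shiftLaw_eq]; infer_instance

theorem cubeIntegral_eq {k : ℕ} {K : ℝ} (hK : 0 < K) (g : (Fin k → ℝ) → ℝ) :
    cubeIntegral K g = ∫ x, (2 * K) ^ k * g (fun j => 2 * K * x j - K) ∂unitCubeMeasure k := by
  have h2K : (0 : ℝ) < 2 * K := by linarith
  have hmeas : MeasurableSet (dataCube k K) := measurableSet_Icc
  unfold cubeIntegral
  rw [← integral_indicator hmeas]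
  have h1 := integral_sub_right_eq_self (μ := (volume : Measure (Fin k → ℝ)))
    ((dataCube k K).indicator g) (fun _ => K)
  have h2 := Measure.integral_comp_smul (volume : Measure (Fin k → ℝ))
    (fun y => (dataCube k K).indicator g (y - fun _ => K)) (2 * K)
  rw [h1, Module.finrank_fin_fun, abs_of_pos (by positivity), smul_eq_mul] at h2
  rw [integral_const_mul, ← restrict_Icc_eq_unitCubeMeasure, ← integral_indicator measurableSet_Icc]
  have h3 : ∀ x : Fin k → ℝ, (dataCube k K).indicator g ((2 * K) • x - fun _ => K) =
      (Set.Icc (fun _ => 0) (fun _ => 1) : Set (Fin k → ℝ)).indicator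
        (fun x => g (fun j => 2 * K * x j - K)) x := by
    intro x
    have hiff : ((2 * K) • x - fun _ => K) ∈ dataCube k K ↔
        x ∈ (Set.Icc (fun _ => 0) (fun _ => 1) : Set (Fin k → ℝ)) := by
      simp only [dataCube, Set.mem_Icc, Pi.le_def, Pi.sub_apply, Pi.smul_apply, smul_eq_mul]
      refine and_congr (forall_congr' fun j => ?_) (forall_congr' fun j => ?_)
      · rw [neg_le_sub_iff_le_add, le_add_iff_nonneg_left, mul_nonneg_iff_of_pos_left h2K]
      · rw [sub_le_iff_le_add, show K + K = 2 * K * 1 by ring, mul_le_mul_iff_right₀ h2K]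
    by_cases hx : x ∈ (Set.Icc (fun _ => 0) (fun _ => 1) : Set (Fin k → ℝ))
    · rw [Set.indicator_of_mem hx, Set.indicator_of_mem (hiff.2 hx)]
      rfl
    · rw [Set.indicator_of_notMem hx, Set.indicator_of_notMem (mt hiff.1 hx)]
  simp only [h3] at h2
  rw [h2, mul_inv_cancel_left₀ (by positivity)]

/-- The cubature error of a single shift. -/
noncomputable def singleShiftError {k : ℕ} (n : ℕ) (K : ℝ) (z : Fin k → ℕ)
    (g : (Fin k → ℝ) → ℝ) (Δ : Fin k → ℝ) : ℝ :=
  cubeIntegral K g - (2 * K) ^ k * (1 / (n : ℝ)) * ∑ i ∈ Finset.Icc 1 n,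
    g (fun j => 2 * K * Int.fract (latticePoint n z i j + Δ j) - K)

theorem cubatureError_eq {k n R : ℕ} (hR : 1 ≤ R) (K : ℝ) (z : Fin k → ℕ)
    (g : (Fin k → ℝ) → ℝ) (Δ : Fin R → Fin k → ℝ) :
    cubatureError n R K z g Δ = (1 / (R : ℝ)) * ∑ r, singleShiftError n K z g (Δ r) := by
  have hR' : (R : ℝ) ≠ 0 := by positivity
  unfold cubatureError shiftedLatticeRule singleShiftError
  rw [Finset.sum_sub_distrib, ← Finset.mul_sum]
  simp only [Finset.sum_const, Finset.card_univ, Fintype.card_fin, nsmul_eq_mul]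
  field_simp

/-- The root-mean-square error of randomly shifted lattice rules for a function on `[-K, K]^k` with
a separately holomorphic extension. -/
theorem memLp_and_rmsError_le {k n : ℕ} (hn : n ≠ 0) (z : Fin k → ℕ) {K : ℝ} (hK : 0 < K)
    {g : (Fin k → ℝ) → ℝ} (hg : Continuous g) {U : Set ℂ} {r M : ℝ} (hr : 0 < r) (hM : 0 ≤ M)
    (hU : ∀ t : ℝ, t ∈ Set.Icc (-K) K → Metric.closedBall (t : ℂ) r ⊆ U)
    {Fc : (Fin k → ℂ) → ℂ} (hFc : IsSepHolomorphicOn U M Fc)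
    (hext : ∀ y ∈ dataCube k K, Fc (fun j => (y j : ℂ)) = g y) {R : ℕ} (hR : 1 ≤ R) :
    MemLp (cubatureError n R K z g) 2 (shiftLaw k R) ∧
      rmsError n R K z g ≤ Real.sqrt (∑ u : Finset (Fin k) with u.Nonempty,
        ((2 * K) ^ k * M) ^ 2 * (2 * Real.pi ^ 2 * (2 * K / r) ^ 2) ^ #u * latticeSum n z u) := by
  have h2K : (0 : ℝ) < 2 * K := by linarith
  set e : (Fin k → ℝ) → ℝ := singleShiftError n K z g
  let F : (Fin k → ℝ) → ℂ := fun x => (((2 * K) ^ k * g (fun j => 2 * K * x j - K) : ℝ) : ℂ)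
  have haff : ∀ {t : ℝ}, t ∈ Set.Icc (0 : ℝ) 1 → 2 * K * t - K ∈ Set.Icc (-K) K := fun {t} ht =>
    ⟨by nlinarith [ht.1], by nlinarith [ht.2]⟩
  have hFm : Measurable F := by
    refine Continuous.measurable ?_
    fun_prop
  have hdiff : ∀ (u : Finset (Fin k)) (a b : Fin k → ℝ), (∀ i, a i ∈ Set.Icc (0 : ℝ) 1) →
      (∀ i, b i ∈ Set.Icc (0 : ℝ) 1) →
      ‖∑ v ∈ u.powerset, (-1 : ℂ) ^ #v * F (v.piecewise b a)‖ ≤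
        ((2 * K) ^ k * M) * ∏ j ∈ u, ((2 * K / r) * |a j - b j|) := by
    intro u a b ha hb
    -- The increments run along the real segment, which is convex in `ℂ` and has distance room `r`
    -- inside `U`.
    let S : Set ℂ := Complex.ofReal '' Set.Icc (-K) K
    have hS : Convex ℝ S := (convex_Icc (-K) K).linear_image Complex.ofRealCLM.toLinearMap
    have hSU : ∀ t ∈ S, Metric.closedBall t r ⊆ U := by
      rintro _ ⟨t, ht, rfl⟩
      exact hU t ht
    let A : (Fin k → ℝ) → Fin k → ℂ := fun x j => ((2 * K * x j - K : ℝ) : ℂ)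
    have hA : ∀ x : Fin k → ℝ, (∀ i, x i ∈ Set.Icc (0 : ℝ) 1) → ∀ i, A x i ∈ S := fun x hx i =>
      ⟨_, haff (hx i), rfl⟩
    have hkey := hFc.norm_mixedDifference_le hr hS hSU (hA a ha) (hA b hb) u
    have hterm : ∀ v : Finset (Fin k), F (v.piecewise b a) =
        ((2 * K) ^ k : ℝ) * Fc (v.piecewise (A b) (A a)) := by
      intro v
      have hmem : ∀ i, v.piecewise b a i ∈ Set.Icc (0 : ℝ) 1 := by
        intro i
        by_cases hi : i ∈ v
        · rw [Finset.piecewise_eq_of_mem _ _ _ hi]; exact hb i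
        · rw [Finset.piecewise_eq_of_notMem _ _ _ hi]; exact ha i
      have hpw : v.piecewise (A b) (A a) =
          fun j => ((2 * K * v.piecewise b a j - K : ℝ) : ℂ) := by
        funext i
        by_cases hi : i ∈ v
        · simp only [Finset.piecewise_eq_of_mem _ _ _ hi, A]
        · simp only [Finset.piecewise_eq_of_notMem _ _ _ hi, A]
      rw [hpw, hext (fun j => 2 * K * v.piecewise b a j - K)
        ⟨fun i => (haff (hmem i)).1, fun i => (haff (hmem i)).2⟩]
      simp [F]
    simp only [hterm, mul_left_comm _ (((2 * K) ^ k : ℝ) : ℂ)]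
    rw [← Finset.mul_sum, norm_mul, Complex.norm_real, Real.norm_of_nonneg (by positivity),
      mul_assoc]
    refine mul_le_mul_of_nonneg_left (hkey.trans_eq ?_) (by positivity)
    congr 1
    refine Finset.prod_congr rfl fun j _ => ?_
    have : A a j - A b j = ((2 * K * (a j - b j) : ℝ) : ℂ) := by
      simp only [A]; push_cast; ring
    rw [this, Complex.norm_real, Real.norm_eq_abs, abs_mul, abs_of_pos h2K]
    ring
  have hFb : ∀ x : Fin k → ℝ, (∀ i, x i ∈ Set.Icc (0 : ℝ) 1) → ‖F x‖ ≤ (2 * K) ^ k * M :=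
    fun x hx => by simpa using hdiff ∅ x x hx hx
  have hmain := integral_sq_norm_lattice_error_le hn z hFm (M := (2 * K) ^ k * M) (L := 2 * K / r)
    (by positivity) (by positivity) hdiff
  have hec : ∀ Δ : Fin k → ℝ, ∫ x, F x ∂unitCubeMeasure k - (1 / (n : ℂ)) *
      ∑ i ∈ Finset.Icc 1 n, F (fun j => Int.fract (latticePoint n z i j + Δ j)) = (e Δ : ℂ) := by
    intro Δ
    have hI : ∫ x, F x ∂unitCubeMeasure k = (cubeIntegral K g : ℂ) := by
      rw [cubeIntegral_eq hK]
      exact integral_ofReal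
    rw [hI]
    simp only [e, singleShiftError, F]
    push_cast
    rw [← Finset.mul_sum]
    ring
  simp only [hec, Complex.norm_real, Real.norm_eq_abs, sq_abs] at hmain
  have hem : Measurable e := by
    refine measurable_const.sub (measurable_const.mul (Finset.measurable_sum _ fun i _ => ?_))
    refine hg.measurable.comp (measurable_pi_lambda _ fun j => ?_)
    exact ((measurable_fract.comp (measurable_const.add (measurable_pi_apply j))).const_mul
      _).sub_const _
  obtain ⟨B, hB⟩ : ∃ B, ∀ Δ, |e Δ| ≤ B := by
    refine ⟨‖∫ x, F x ∂unitCubeMeasure k‖ + ‖1 / (n : ℂ)‖ *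
      ∑ i ∈ Finset.Icc 1 n, (2 * K) ^ k * M, fun Δ => ?_⟩
    rw [← Real.norm_eq_abs, ← Complex.norm_real, ← hec]
    refine (norm_sub_le _ _).trans (add_le_add le_rfl ?_)
    rw [norm_mul]
    exact mul_le_mul_of_nonneg_left ((norm_sum_le _ _).trans (Finset.sum_le_sum fun i _ =>
      hFb _ fun j => ⟨Int.fract_nonneg _, (Int.fract_lt_one _).le⟩)) (norm_nonneg _)
  have hR0 : (0 : ℝ) < R := by exact_mod_cast hR
  have hcm : Measurable (cubatureError n R K z g) := by
    have : cubatureError n R K z g = fun Δ => (1 / (R : ℝ)) * ∑ r, e (Δ r) :=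
      funext fun Δ => cubatureError_eq hR K z g Δ
    rw [this]
    exact measurable_const.mul (Finset.measurable_sum _ fun r _ =>
      hem.comp (measurable_pi_apply r))
  -- By Cauchy–Schwarz the square of an average is at most the average of the squares; as all shifts
  -- have the same law, the single-shift bound holds for every `R`.
  have hpt : ∀ Δ, |cubatureError n R K z g Δ| ^ 2 ≤ (1 / (R : ℝ)) * ∑ r, e (Δ r) ^ 2 := by
    intro Δ
    rw [sq_abs, cubatureError_eq hR, mul_pow]
    have hcs := sq_sum_le_card_mul_sum_sq (s := (Finset.univ : Finset (Fin R)))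
      (f := fun r => e (Δ r))
    rw [Finset.card_univ, Fintype.card_fin] at hcs
    calc (1 / (R : ℝ)) ^ 2 * (∑ r, e (Δ r)) ^ 2
        ≤ (1 / (R : ℝ)) ^ 2 * (R * ∑ r, e (Δ r) ^ 2) :=
          mul_le_mul_of_nonneg_left hcs (by positivity)
      _ = _ := by field_simp
  have hsqint : Integrable (fun x => e x ^ 2) (unitCubeMeasure k) :=
    Integrable.of_bound (hem.pow_const 2).aestronglyMeasurable (B ^ 2)
      (Filter.Eventually.of_forall fun x => by
        rw [Real.norm_of_nonneg (sq_nonneg _), ← sq_abs]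
        exact pow_le_pow_left₀ (abs_nonneg _) (hB x) 2)
  have hmp : ∀ r : Fin R, MeasurePreserving (Function.eval r) (shiftLaw k R)
      (unitCubeMeasure k) := fun r => by
    rw [shiftLaw_eq]
    exact measurePreserving_eval (fun _ : Fin R => unitCubeMeasure k) r
  have hrint : ∀ r : Fin R, Integrable (fun Δ => e (Δ r) ^ 2) (shiftLaw k R) := fun r =>
    (hmp r).integrable_comp_of_integrable hsqint
  have hrval : ∀ r : Fin R, ∫ Δ, e (Δ r) ^ 2 ∂shiftLaw k R = ∫ x, e x ^ 2 ∂unitCubeMeasure k := by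
    intro r
    rw [← (hmp r).map_eq, integral_map (hmp r).measurable.aemeasurable
      (hem.pow_const 2).aestronglyMeasurable]
  have hmem : MemLp (cubatureError n R K z g) 2 (shiftLaw k R) := by
    rw [memLp_two_iff_integrable_sq hcm.aestronglyMeasurable]
    refine Integrable.mono' ((integrable_finsetSum Finset.univ fun r _ => hrint r).const_mul
      (1 / (R : ℝ))) (hcm.pow_const 2).aestronglyMeasurable
      (Filter.Eventually.of_forall fun Δ => ?_)
    rw [Real.norm_of_nonneg (sq_nonneg _), ← sq_abs]
    exact hpt Δ
  refine ⟨hmem, Real.sqrt_le_sqrt ?_⟩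
  calc ∫ Δ, |cubatureError n R K z g Δ| ^ 2 ∂shiftLaw k R
      ≤ ∫ Δ, (1 / (R : ℝ)) * ∑ r, e (Δ r) ^ 2 ∂shiftLaw k R := by
        refine integral_mono ?_ ((integrable_finsetSum Finset.univ fun r _ =>
          hrint r).const_mul _) hpt
        simpa only [sq_abs] using hmem.integrable_sq
    _ = ∫ x, e x ^ 2 ∂unitCubeMeasure k := by
        rw [integral_const_mul, integral_finsetSum _ fun r _ => hrint r]
        simp only [hrval, Finset.sum_const, Finset.card_univ, Fintype.card_fin, nsmul_eq_mul]
        field_simp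
    _ ≤ _ := hmain

/-! ### Bounds for the inverse covariance and the normalization. -/

section Matrix

variable {k : ℕ} {Γ : Matrix (Fin k) (Fin k) ℝ}

/-- The spectrum of `Γ - μ I` is that of `Γ` shifted by `-μ`, so this matrix is positive
semidefinite. -/
theorem mul_dotProduct_self_le_of_le_eigenvalues (hΓ : Γ.IsHermitian) {μ : ℝ}
    (hμ : ∀ i, μ ≤ hΓ.eigenvalues i) (x : Fin k → ℝ) : μ * (x ⬝ᵥ x) ≤ x ⬝ᵥ (Γ.mulVec x) := by
  have hpos : (Γ - algebraMap ℝ _ μ).PosSemidef := by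
    rw [Matrix.posSemidef_iff_isHermitian_and_spectrum_nonneg]
    refine ⟨hΓ.sub ?_, ?_⟩
    · rw [Matrix.algebraMap_eq_diagonal]
      exact Matrix.isHermitian_diagonal _
    · rw [← spectrum.sub_singleton_eq, hΓ.spectrum_real_eq_range_eigenvalues]
      rintro _ ⟨_, ⟨i, rfl⟩, _, rfl, rfl⟩
      exact sub_nonneg.2 (hμ i)
  have h := hpos.dotProduct_mulVec_nonneg x
  rw [Matrix.sub_mulVec, dotProduct_sub, Algebra.algebraMap_eq_smul_one, Matrix.smul_mulVec,
    Matrix.one_mulVec, dotProduct_smul, smul_eq_mul, star_trivial] at h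
  linarith

theorem dotProduct_sq_le (x y : Fin k → ℝ) : (x ⬝ᵥ y) ^ 2 ≤ (x ⬝ᵥ x) * (y ⬝ᵥ y) := by
  have := Finset.sum_mul_sq_le_sq_mul_sq Finset.univ x y
  simpa only [dotProduct, sq] using this

theorem dotProduct_self_nonneg (x : Fin k → ℝ) : 0 ≤ x ⬝ᵥ x :=
  Finset.sum_nonneg fun i _ => mul_self_nonneg (x i)

theorem inv_mulVec_dotProduct_nonneg (hΓ : Γ.PosDef) (x : Fin k → ℝ) :
    0 ≤ x ⬝ᵥ (Γ⁻¹.mulVec x) := by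
  simpa using hΓ.inv.posSemidef.dotProduct_mulVec_nonneg x

theorem inv_mulVec_dotProduct_comm (hΓ : Γ.PosDef) (x y : Fin k → ℝ) :
    x ⬝ᵥ (Γ⁻¹.mulVec y) = y ⬝ᵥ (Γ⁻¹.mulVec x) := by
  have hT : (Γ⁻¹).transpose = Γ⁻¹ := by
    have := hΓ.inv.isHermitian
    rwa [Matrix.IsHermitian, Matrix.conjTranspose_eq_transpose_of_trivial] at this
  rw [dotProduct_comm, ← Matrix.vecMul_transpose, hT, ← Matrix.dotProduct_mulVec]

/-- This is `‖Γ⁻¹‖ ≤ 1/μ`. For `v = Γ⁻¹ y` one has `μ |v|² ≤ v·y ≤ |v| |y|`, hence `μ |v| ≤ |y|`,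
and Cauchy–Schwarz applies to `x·v`. -/
theorem inv_mulVec_dotProduct_sq_le (hΓ : Γ.PosDef) {μ : ℝ} (hμ0 : 0 < μ)
    (hμ : ∀ i, μ ≤ hΓ.isHermitian.eigenvalues i) (x y : Fin k → ℝ) :
    (μ * (x ⬝ᵥ (Γ⁻¹.mulVec y))) ^ 2 ≤ (x ⬝ᵥ x) * (y ⬝ᵥ y) := by
  set v := Γ⁻¹.mulVec y
  have hv : Γ.mulVec v = y := by
    rw [Matrix.mulVec_mulVec, Matrix.mul_nonsing_inv _ ((Matrix.isUnit_iff_isUnit_det _).1 hΓ.isUnit),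
      Matrix.one_mulVec]
  have h1 := mul_dotProduct_self_le_of_le_eigenvalues hΓ.isHermitian hμ v
  rw [hv] at h1
  have h2 := dotProduct_sq_le v y
  have hvv := dotProduct_self_nonneg v
  have hyy := dotProduct_self_nonneg y
  have hxx := dotProduct_self_nonneg x
  have h3 : μ ^ 2 * (v ⬝ᵥ v) ≤ y ⬝ᵥ y := by
    rcases hvv.eq_or_lt with h0 | h0
    · rw [← h0, mul_zero]; exact hyy
    · have h4 : (μ * (v ⬝ᵥ v)) ^ 2 ≤ (v ⬝ᵥ v) * (y ⬝ᵥ y) :=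
        (pow_le_pow_left₀ (by positivity) h1 2).trans h2
      refine le_of_mul_le_mul_left ?_ h0
      linarith [h4, show (μ * (v ⬝ᵥ v)) ^ 2 = (v ⬝ᵥ v) * (μ ^ 2 * (v ⬝ᵥ v)) by ring]
  calc (μ * (x ⬝ᵥ v)) ^ 2 = μ ^ 2 * (x ⬝ᵥ v) ^ 2 := by ring
    _ ≤ μ ^ 2 * ((x ⬝ᵥ x) * (v ⬝ᵥ v)) :=
        mul_le_mul_of_nonneg_left (dotProduct_sq_le x v) (sq_nonneg μ)
    _ = (x ⬝ᵥ x) * (μ ^ 2 * (v ⬝ᵥ v)) := by ring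
    _ ≤ _ := mul_le_mul_of_nonneg_left h3 hxx

theorem inv_mulVec_dotProduct_self_le (hΓ : Γ.PosDef) {μ : ℝ} (hμ0 : 0 < μ)
    (hμ : ∀ i, μ ≤ hΓ.isHermitian.eigenvalues i) (x : Fin k → ℝ) :
    x ⬝ᵥ (Γ⁻¹.mulVec x) ≤ (x ⬝ᵥ x) / μ := by
  rw [le_div_iff₀ hμ0, mul_comm]
  refine le_of_sq_le_sq ?_ (dotProduct_self_nonneg x)
  rw [sq (x ⬝ᵥ x)]
  exact inv_mulVec_dotProduct_sq_le hΓ hμ0 hμ x x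

theorem gaussNorm_pos (hΓ : Γ.PosDef) : 0 < gaussNorm Γ := by
  have : 0 < ((2 * Real.pi) • Γ).det := (hΓ.smul Real.two_pi_pos).det_pos
  unfold gaussNorm
  positivity

theorem gaussNorm_le (hΓ : Γ.PosDef) {μ : ℝ} (hμ0 : 0 < μ)
    (hμ : ∀ i, μ ≤ hΓ.isHermitian.eigenvalues i) :
    gaussNorm Γ ≤ 1 / Real.sqrt ((2 * Real.pi * μ) ^ k) := by
  have hpi := Real.two_pi_pos
  unfold gaussNorm
  refine one_div_le_one_div_of_le (Real.sqrt_pos.2 (by positivity)) (Real.sqrt_le_sqrt ?_)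
  rw [Matrix.det_smul, Fintype.card_fin, mul_pow, hΓ.isHermitian.det_eq_prod_eigenvalues]
  refine mul_le_mul_of_nonneg_left ?_ (by positivity)
  calc μ ^ k = ∏ _i : Fin k, μ := by simp
    _ ≤ _ := Finset.prod_le_prod (fun _ _ => hμ0.le) fun i _ => hμ i

end Matrix

/-! ### Holomorphic extension of the evidence and of the outer integrand. -/

/-- Serves for `x = gaussNorm Γ`, which has an upper bound only: large eigenvalues of `Γ` make its
logarithm arbitrarily negative, but `x log x` stays bounded. -/
theorem abs_mul_log_le {x y : ℝ} (hx : 0 < x) (hxy : x ≤ y) : |x * Real.log x| ≤ 1 + y ^ 2 := by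
  rcases le_or_gt x 1 with h | h
  · have := Real.abs_log_mul_self_lt x hx h
    rw [mul_comm]
    nlinarith [sq_nonneg y]
  · rw [abs_of_nonneg (mul_nonneg hx.le (Real.log_nonneg h.le))]
    have h1 := Real.log_le_sub_one_of_pos hx
    nlinarith

/-- Holomorphy of parametric integrals of locally bounded holomorphic functions. -/
theorem differentiableAt_integral_of_locally_bounded {α : Type*} [MeasurableSpace α]
    {ν : Measure α} [IsFiniteMeasure ν] {Φ : ℂ → α → ℂ} {t₀ : ℂ} {c : ℝ}
    (hmeas : ∀ t, AEStronglyMeasurable (Φ t) ν)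
    (hdiff : ∀ θ, Differentiable ℂ fun t => Φ t θ)
    (hbound : ∀ᵐ θ ∂ν, ∀ t ∈ Metric.closedBall t₀ 2, ‖Φ t θ‖ ≤ c) :
    DifferentiableAt ℂ (fun t => ∫ θ, Φ t θ ∂ν) t₀ := by
  -- The derivative is a pointwise limit of difference quotients along a sequence, each of them
  -- measurable in `θ`.
  have hderiv_meas : AEStronglyMeasurable (fun θ => deriv (fun t => Φ t θ) t₀) ν := by
    have hseq : Filter.Tendsto (fun m : ℕ => t₀ + 1 / ((m : ℂ) + 1)) Filter.atTop
        (nhdsWithin t₀ {t₀}ᶜ) := by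
      refine tendsto_nhdsWithin_iff.2 ⟨?_, Filter.Eventually.of_forall fun m => ?_⟩
      · simpa using (tendsto_const_nhds (x := t₀)).add
          (tendsto_one_div_add_atTop_nhds_zero_nat (𝕜 := ℂ))
      · have : (m : ℂ) + 1 ≠ 0 := by exact_mod_cast Nat.succ_ne_zero m
        simp [this]
    refine aestronglyMeasurable_of_tendsto_ae Filter.atTop
      (f := fun (m : ℕ) θ => slope (fun t => Φ t θ) t₀ (t₀ + 1 / ((m : ℂ) + 1))) (fun m => ?_)
      (Filter.Eventually.of_forall fun θ =>
        (hasDerivAt_iff_tendsto_slope.1 ((hdiff θ) t₀).hasDerivAt).comp hseq)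
    simp only [slope_def_module]
    exact ((hmeas (t₀ + 1 / ((m : ℂ) + 1))).sub (hmeas t₀)).const_smul
      ((t₀ + 1 / ((m : ℂ) + 1) - t₀)⁻¹ : ℂ)
  refine (hasDerivAt_integral_of_dominated_loc_of_deriv_le (s := Metric.ball t₀ 1)
    (F' := fun t θ => deriv (fun t => Φ t θ) t) (bound := fun _ => c / 1)
    (Metric.ball_mem_nhds t₀ one_pos) (Filter.Eventually.of_forall hmeas) ?_ hderiv_meas ?_
    (integrable_const _)
    (Filter.Eventually.of_forall fun θ t _ => ((hdiff θ) t).hasDerivAt)).2.differentiableAt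
  · refine Integrable.of_bound (hmeas t₀) c (hbound.mono fun θ h => h t₀ ?_)
    exact Metric.mem_closedBall_self two_pos.le
  -- Cauchy's estimate on the unit circle about `t`, which stays within distance `2` of `t₀`.
  · refine hbound.mono fun θ h t ht => ?_
    refine Complex.norm_deriv_le_of_forall_mem_sphere_norm_le one_pos
      (hdiff θ).diffContOnCl fun w hw => h w ?_
    rw [Metric.mem_closedBall]
    rw [Metric.mem_ball] at ht
    rw [Metric.mem_sphere] at hw
    linarith [dist_triangle w t t₀]

section Evidence

variable {k s : ℕ} {Γ : Matrix (Fin k) (Fin k) ℝ} {G : (Fin s → ℝ) → EuclideanSpace ℝ (Fin k)}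

/-- The complex bilinear extension of `x ↦ xᵀ Γ⁻¹ x`. -/
noncomputable def complexQuadForm (Γ : Matrix (Fin k) (Fin k) ℝ) (w : Fin k → ℂ) : ℂ :=
  ∑ i, ∑ j, w i * ((Γ⁻¹ i j : ℝ) : ℂ) * w j

theorem complexQuadForm_re (w : Fin k → ℂ) : (complexQuadForm Γ w).re =
    (fun i => (w i).re) ⬝ᵥ (Γ⁻¹.mulVec fun i => (w i).re) -
      (fun i => (w i).im) ⬝ᵥ (Γ⁻¹.mulVec fun i => (w i).im) := by
  simp only [complexQuadForm, dotProduct, Matrix.mulVec, Complex.re_sum, Finset.mul_sum,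
    ← Finset.sum_sub_distrib]
  refine Finset.sum_congr rfl fun i _ => Finset.sum_congr rfl fun j _ => ?_
  simp only [Complex.mul_re, Complex.mul_im, Complex.ofReal_re, Complex.ofReal_im]
  ring

theorem complexQuadForm_im (hΓ : Γ.PosDef) (w : Fin k → ℂ) : (complexQuadForm Γ w).im =
    2 * ((fun i => (w i).re) ⬝ᵥ (Γ⁻¹.mulVec fun i => (w i).im)) := by
  have h : (complexQuadForm Γ w).im =
      (fun i => (w i).re) ⬝ᵥ (Γ⁻¹.mulVec fun i => (w i).im) +
        (fun i => (w i).im) ⬝ᵥ (Γ⁻¹.mulVec fun i => (w i).re) := by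
    simp only [complexQuadForm, dotProduct, Matrix.mulVec, Complex.im_sum, Finset.mul_sum,
      ← Finset.sum_add_distrib]
    refine Finset.sum_congr rfl fun i _ => Finset.sum_congr rfl fun j _ => ?_
    simp only [Complex.mul_re, Complex.mul_im, Complex.ofReal_re, Complex.ofReal_im]
    ring
  rw [h, inv_mulVec_dotProduct_comm hΓ (fun i => (w i).im)]
  ring

/-- The complex Gaussian factor `exp (-(z - g)ᵀ Γ⁻¹ (z - g) / 2)`. -/
noncomputable def complexGauss (Γ : Matrix (Fin k) (Fin k) ℝ) (z : Fin k → ℂ)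
    (g : EuclideanSpace ℝ (Fin k)) : ℂ :=
  Complex.exp (-(1 / 2) * complexQuadForm Γ fun i => z i - ((g i : ℝ) : ℂ))

/-- The holomorphic extension of the evidence, without the normalization. -/
noncomputable def complexEvidence (Γ : Matrix (Fin k) (Fin k) ℝ)
    (G : (Fin s → ℝ) → EuclideanSpace ℝ (Fin k)) (z : Fin k → ℂ) : ℂ :=
  ∫ θ in paramCube s, complexGauss Γ z (G θ)

instance : IsProbabilityMeasure ((volume : Measure (Fin s → ℝ)).restrict (paramCube s)) := by
  refine ⟨?_⟩
  rw [Measure.restrict_apply_univ, paramCube, Real.volume_Icc_pi]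
  norm_num

theorem complexGauss_ofReal (hΓ : Γ.PosDef) (y : Fin k → ℝ) (g : EuclideanSpace ℝ (Fin k)) :
    complexGauss Γ (fun i => (y i : ℂ)) g =
      (Real.exp (-(1 / 2) * weightedNorm Γ (fun i => y i - g i) ^ 2) : ℂ) := by
  have hq : complexQuadForm Γ (fun i => (y i : ℂ) - ((g i : ℝ) : ℂ)) =
      ((weightedNorm Γ (fun i => y i - g i) ^ 2 : ℝ) : ℂ) := by
    refine Complex.ext ?_ ?_
    · rw [complexQuadForm_re, Complex.ofReal_re, weightedNorm,
        Real.sq_sqrt (inv_mulVec_dotProduct_nonneg hΓ _)]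
      simp [dotProduct]
    · rw [complexQuadForm_im hΓ, Complex.ofReal_im]
      simp [Matrix.mulVec, dotProduct]
  unfold complexGauss
  rw [hq]
  push_cast
  rfl

theorem evidence_eq (hΓ : Γ.PosDef) (y : Fin k → ℝ) :
    (evidence Γ G y : ℂ) = gaussNorm Γ * complexEvidence Γ G fun i => (y i : ℂ) := by
  unfold evidence complexEvidence likelihood
  rw [integral_const_mul]
  push_cast
  congr 1
  rw [← integral_complex_ofReal]
  refine integral_congr_ae (Filter.Eventually.of_forall fun θ => ?_)
  simp only [complexGauss_ofReal hΓ]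

theorem continuous_complexGauss {X : Type*} [TopologicalSpace X] {f : X → Fin k → ℂ}
    {g : X → EuclideanSpace ℝ (Fin k)} (hf : Continuous f) (hg : Continuous g) :
    Continuous fun x => complexGauss Γ (f x) (g x) := by
  unfold complexGauss complexQuadForm
  fun_prop

theorem aestronglyMeasurable_complexGauss (hG : ContinuousOn G (paramCube s)) (z : Fin k → ℂ) :
    AEStronglyMeasurable (fun θ => complexGauss Γ z (G θ)) (volume.restrict (paramCube s)) :=
  (continuous_complexGauss continuous_const continuous_id).comp_aestronglyMeasurable
    (hG.aestronglyMeasurable measurableSet_Icc)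

theorem differentiable_complexEvidence {C : ℝ} (hG : ContinuousOn G (paramCube s))
    (hGC : ∀ θ ∈ paramCube s, ‖G θ‖ ≤ C) (z : Fin k → ℂ) (j : Fin k) :
    Differentiable ℂ fun t => complexEvidence Γ G (Function.update z j t) := by
  intro t₀
  have hcont : Continuous fun p : ℂ × EuclideanSpace ℝ (Fin k) =>
      complexGauss Γ (Function.update z j p.1) p.2 := by
    have hupd : Continuous fun p : ℂ × EuclideanSpace ℝ (Fin k) => Function.update z j p.1 :=
      Continuous.update continuous_const j continuous_fst
    exact continuous_complexGauss hupd continuous_snd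
  obtain ⟨c, hc⟩ := ((isCompact_closedBall t₀ 2).prod
    (isCompact_closedBall (0 : EuclideanSpace ℝ (Fin k)) C)).exists_bound_of_continuousOn
      hcont.continuousOn
  refine differentiableAt_integral_of_locally_bounded (c := c)
    (fun t => aestronglyMeasurable_complexGauss hG _) (fun θ => ?_) ?_
  · have hupd : ∀ i, Differentiable ℂ fun t : ℂ => Function.update z j t i := by
      intro i
      by_cases hij : i = j
      · subst hij
        simp
      · simp [Function.update_of_ne hij]
    unfold complexGauss complexQuadForm
    fun_prop
  · filter_upwards [ae_restrict_mem measurableSet_Icc] with θ hθ t ht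
    exact hc (t, G θ) ⟨ht, by simpa using hGC θ hθ⟩

/-- The box of complex numbers with real part in `[-K - 1, K + 1]` and imaginary part in
`[-ρ, ρ]`. -/
def complexBox (K ρ : ℝ) : Set ℂ := {t | |t.re| ≤ K + 1 ∧ |t.im| ≤ ρ}

theorem closedBall_subset_complexBox {K ρ : ℝ} (hρ1 : ρ ≤ 1) {t : ℝ} (ht : t ∈ Set.Icc (-K) K) :
    Metric.closedBall (t : ℂ) ρ ⊆ complexBox K ρ := by
  intro w hw
  rw [Metric.mem_closedBall, Complex.dist_eq] at hw
  have h1 := (Complex.abs_re_le_norm (w - t)).trans hw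
  have h2 := (Complex.abs_im_le_norm (w - t)).trans hw
  simp only [Complex.sub_re, Complex.sub_im, Complex.ofReal_re, Complex.ofReal_im, sub_zero]
    at h1 h2
  refine ⟨?_, h2⟩
  rw [abs_le] at h1 ⊢
  constructor <;> linarith [ht.1, ht.2, h1.1, h1.2]

theorem dotProduct_self_sub_le {K C : ℝ} {x : Fin k → ℝ} {g : EuclideanSpace ℝ (Fin k)}
    (hx : ∀ i, |x i| ≤ K) (hg : ‖g‖ ≤ C) :
    (fun i => x i - g i) ⬝ᵥ (fun i => x i - g i) ≤ 2 * (k * K ^ 2 + C ^ 2) := by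
  have h1 : ∑ i, x i ^ 2 ≤ k * K ^ 2 := by
    calc ∑ i, x i ^ 2 ≤ ∑ _i : Fin k, K ^ 2 := Finset.sum_le_sum fun i _ => by
          rw [← sq_abs]; exact pow_le_pow_left₀ (abs_nonneg _) (hx i) 2
      _ = _ := by simp
  have h2 : ∑ i, g i ^ 2 ≤ C ^ 2 := by
    rw [← EuclideanSpace.real_norm_sq_eq]
    exact pow_le_pow_left₀ (norm_nonneg _) hg 2
  calc (fun i => x i - g i) ⬝ᵥ (fun i => x i - g i)
      ≤ ∑ i, (2 * x i ^ 2 + 2 * g i ^ 2) :=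
        Finset.sum_le_sum fun i _ => by nlinarith [sq_nonneg (x i + g i)]
    _ = 2 * ∑ i, x i ^ 2 + 2 * ∑ i, g i ^ 2 := by
        rw [Finset.sum_add_distrib, Finset.mul_sum, Finset.mul_sum]
    _ ≤ _ := by linarith

/-- Bounds for the Gaussian factor near the real cube, where its argument stays within `[-1, 1]`. -/
theorem complexGauss_bounds (hΓ : Γ.PosDef) {μ K C ρ P : ℝ} (hμ0 : 0 < μ)
    (hμ : ∀ i, μ ≤ hΓ.isHermitian.eigenvalues i) (hρ1 : ρ ≤ 1)
    (hP : 2 * (k * (K + 1) ^ 2 + C ^ 2) ≤ P) (hρP : P * (k * ρ ^ 2) ≤ μ ^ 2) (hρ0 : 0 ≤ ρ)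
    {z : Fin k → ℂ} (hz : ∀ i, z i ∈ complexBox K ρ) {g : EuclideanSpace ℝ (Fin k)}
    (hg : ‖g‖ ≤ C) :
    ‖complexGauss Γ z g‖ ≤ Real.exp (k / (2 * μ)) ∧
      Real.exp (-(P / (2 * μ))) * Real.cos 1 ≤ (complexGauss Γ z g).re := by
  set w : Fin k → ℂ := fun i => z i - ((g i : ℝ) : ℂ)
  set a : Fin k → ℝ := fun i => (w i).re
  set b : Fin k → ℝ := fun i => (w i).im
  have hre := complexQuadForm_re (Γ := Γ) w
  have him := complexQuadForm_im hΓ w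
  have haa : a ⬝ᵥ a ≤ P := by
    have : a = fun i => (z i).re - g i := by
      funext i; simp [a, w]
    rw [this]
    exact (dotProduct_self_sub_le (fun i => (hz i).1) hg).trans hP
  have hbb : b ⬝ᵥ b ≤ k * ρ ^ 2 := by
    have : b = fun i => (z i).im := by
      funext i; simp [b, w]
    rw [this]
    calc (fun i => (z i).im) ⬝ᵥ (fun i => (z i).im) ≤ ∑ _i : Fin k, ρ ^ 2 :=
          Finset.sum_le_sum fun i _ => by
            rw [← sq, ← sq_abs]
            exact pow_le_pow_left₀ (abs_nonneg _) (hz i).2 2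
      _ = _ := by simp
  have hP0 : 0 ≤ P := (dotProduct_self_nonneg a).trans haa
  have hk1 : (k : ℝ) * ρ ^ 2 ≤ k :=
    mul_le_of_le_one_right (Nat.cast_nonneg k) (pow_le_one₀ hρ0 hρ1)
  have hQa0 := inv_mulVec_dotProduct_nonneg hΓ a
  have hQb0 := inv_mulVec_dotProduct_nonneg hΓ b
  have hQa : a ⬝ᵥ (Γ⁻¹.mulVec a) ≤ P / μ :=
    (inv_mulVec_dotProduct_self_le hΓ hμ0 hμ a).trans (by gcongr)
  have hQb : b ⬝ᵥ (Γ⁻¹.mulVec b) ≤ k / μ :=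
    (inv_mulVec_dotProduct_self_le hΓ hμ0 hμ b).trans (by gcongr; exact hbb.trans hk1)
  -- Up to sign this is the phase of the Gaussian factor; within `[-1, 1]` its cosine is at least
  -- `cos 1 > 0`.
  have hab : |a ⬝ᵥ (Γ⁻¹.mulVec b)| ≤ 1 := by
    have h1 := inv_mulVec_dotProduct_sq_le hΓ hμ0 hμ a b
    have h2 : (a ⬝ᵥ a) * (b ⬝ᵥ b) ≤ μ ^ 2 :=
      (mul_le_mul haa hbb (dotProduct_self_nonneg b) hP0).trans hρP
    have h3 : |μ * (a ⬝ᵥ (Γ⁻¹.mulVec b))| ≤ μ := by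
      rw [← abs_of_pos hμ0, ← sq_le_sq, abs_of_pos hμ0]
      exact h1.trans h2
    rw [abs_mul, abs_of_pos hμ0] at h3
    exact le_of_mul_le_mul_left (by linarith) hμ0
  have hexp_re : (-(1 / 2) * complexQuadForm Γ w).re =
      -(1 / 2) * (a ⬝ᵥ (Γ⁻¹.mulVec a) - b ⬝ᵥ (Γ⁻¹.mulVec b)) := by
    rw [← hre]; simp [Complex.mul_re]
  have hexp_im : (-(1 / 2) * complexQuadForm Γ w).im = -(a ⬝ᵥ (Γ⁻¹.mulVec b)) := by
    have : (-(1 / 2) * complexQuadForm Γ w).im = -(1 / 2) * (complexQuadForm Γ w).im := by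
      simp [Complex.mul_im]
    rw [this, him]; ring
  have hhalfP : P / (2 * μ) = 1 / 2 * (P / μ) := by field_simp
  have hhalfk : (k : ℝ) / (2 * μ) = 1 / 2 * (k / μ) := by field_simp
  constructor
  · unfold complexGauss
    rw [Complex.norm_exp]
    refine Real.exp_le_exp.2 ?_
    rw [hexp_re, hhalfk]
    linarith
  · unfold complexGauss
    rw [Complex.exp_re, hexp_re, hexp_im, Real.cos_neg]
    refine mul_le_mul (Real.exp_le_exp.2 ?_) ?_ Real.cos_one_pos.le (Real.exp_pos _).le
    · rw [hhalfP]
      linarith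
    · rw [← Real.cos_abs (a ⬝ᵥ (Γ⁻¹.mulVec b))]
      exact Real.cos_le_cos_of_nonneg_of_le_pi (abs_nonneg _)
        (by linarith [Real.pi_gt_three]) hab

/-- Discs and half-planes are convex, so averaging over the prior, a probability measure for every
`s`, preserves both bounds. -/
theorem complexEvidence_bounds (hG : ContinuousOn G (paramCube s)) {z : Fin k → ℂ} {D c : ℝ}
    (hD : ∀ θ ∈ paramCube s, ‖complexGauss Γ z (G θ)‖ ≤ D)
    (hc : ∀ θ ∈ paramCube s, c ≤ (complexGauss Γ z (G θ)).re) :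
    ‖complexEvidence Γ G z‖ ≤ D ∧ c ≤ (complexEvidence Γ G z).re := by
  have hae : ∀ᵐ θ ∂(volume : Measure (Fin s → ℝ)).restrict (paramCube s), θ ∈ paramCube s :=
    ae_restrict_mem measurableSet_Icc
  have hint : Integrable (fun θ => complexGauss Γ z (G θ)) (volume.restrict (paramCube s)) :=
    Integrable.of_bound (aestronglyMeasurable_complexGauss hG z) D (hae.mono hD)
  constructor
  · exact (norm_integral_le_of_norm_le_const (hae.mono hD)).trans_eq (by simp)
  · unfold complexEvidence
    have : (∫ θ in paramCube s, complexGauss Γ z (G θ)).re =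
        ∫ θ in paramCube s, (complexGauss Γ z (G θ)).re := (integral_re hint).symm
    rw [this]
    calc c = ∫ _θ in paramCube s, c := by simp
      _ ≤ _ := integral_mono_ae (integrable_const _) hint.re (hae.mono hc)

theorem continuous_evidence (hΓ : Γ.PosDef) (hG : ContinuousOn G (paramCube s)) :
    Continuous (evidence Γ G) := by
  have hcomp : ∀ y θ, (likelihood Γ G θ y : ℂ) =
      gaussNorm Γ * complexGauss Γ (fun i => (y i : ℂ)) (G θ) := fun y θ => by
    rw [complexGauss_ofReal hΓ, likelihood]
    push_cast
    rfl
  have hre : ∀ y θ, likelihood Γ G θ y =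
      (gaussNorm Γ * complexGauss Γ (fun i => (y i : ℂ)) (G θ)).re := fun y θ => by
    rw [← hcomp, Complex.ofReal_re]
  refine continuous_of_dominated (bound := fun _ => gaussNorm Γ) (fun y => ?_) (fun y => ?_)
    (integrable_const _) (Filter.Eventually.of_forall fun θ => ?_)
  · simp only [hre]
    exact Complex.continuous_re.comp_aestronglyMeasurable
      ((aestronglyMeasurable_complexGauss hG _).const_mul _)
  · refine Filter.Eventually.of_forall fun θ => ?_
    rw [likelihood, norm_mul, Real.norm_of_nonneg (gaussNorm_pos hΓ).le,
      Real.norm_of_nonneg (Real.exp_pos _).le]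
    refine mul_le_of_le_one_right (gaussNorm_pos hΓ).le (Real.exp_le_one_iff.2 ?_)
    nlinarith [sq_nonneg (weightedNorm Γ fun i => y i - G θ i)]
  · simp only [hre]
    exact Complex.continuous_re.comp
      (continuous_const.mul
      (continuous_complexGauss (by fun_prop) continuous_const))

end Evidence

/-- The outer integrand has a separately holomorphic extension to a complex neighbourhood of the
data cube; its size and the bound depend only on `k`, `K`, `C` and `μ`. -/
theorem exists_holomorphic_extension (k : ℕ) (hk : 1 ≤ k) {K C μ : ℝ} (hC : 1 ≤ C)
    (hμ0 : 0 < μ) :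
    ∃ ρ M : ℝ, 0 < ρ ∧ ρ ≤ 1 ∧ 0 ≤ M ∧
      ∀ (s : ℕ) (Γ : Matrix (Fin k) (Fin k) ℝ) (hΓ : Γ.PosDef)
        (G : (Fin s → ℝ) → EuclideanSpace ℝ (Fin k)),
        (∀ i, μ ≤ hΓ.isHermitian.eigenvalues i) → ContinuousOn G (paramCube s) →
        (∀ θ ∈ paramCube s, ‖G θ‖ ≤ C) →
        ∃ Fc : (Fin k → ℂ) → ℂ, IsSepHolomorphicOn (complexBox K ρ) M Fc ∧
          ∀ y ∈ dataCube k K, Fc (fun j => (y j : ℂ)) = outerIntegrand Γ G y := by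
  have hk0 : (0 : ℝ) < k := by exact_mod_cast hk
  set P : ℝ := 2 * (k * (K + 1) ^ 2 + C ^ 2)
  have hP0 : 0 < P := by positivity
  -- `P` bounds `|Re z - G θ|²` on the box and `k ρ²` bounds `|Im z|²`; this `ρ` makes their product
  -- at most `μ²`, as the phase bound requires.
  set ρ : ℝ := min 1 (μ / Real.sqrt (P * k))
  have hPk : 0 < P * k := by positivity
  have hρ0 : 0 < ρ := lt_min one_pos (div_pos hμ0 (Real.sqrt_pos.2 hPk))
  have hρ1 : ρ ≤ 1 := min_le_left _ _
  have hρP : P * (k * ρ ^ 2) ≤ μ ^ 2 := by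
    have h1 : ρ ^ 2 ≤ (μ / Real.sqrt (P * k)) ^ 2 :=
      pow_le_pow_left₀ hρ0.le (min_le_right _ _) 2
    rw [div_pow, Real.sq_sqrt hPk.le, le_div_iff₀ hPk] at h1
    linarith
  set c : ℝ := Real.exp (-(P / (2 * μ))) * Real.cos 1
  have hc0 : 0 < c := mul_pos (Real.exp_pos _) Real.cos_one_pos
  set D : ℝ := Real.exp (k / (2 * μ))
  have hD0 : 0 < D := Real.exp_pos _
  set N₀ : ℝ := 1 / Real.sqrt ((2 * Real.pi * μ) ^ k)
  have hpi := Real.pi_pos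
  have hN₀ : 0 < N₀ := by positivity
  -- Bounds the principal logarithm of a number with modulus in `[c, D]`; the `π` is for the
  -- argument.
  set Λ : ℝ := |Real.log c| + |Real.log D| + Real.pi
  have hΛ : 0 ≤ Λ := by positivity
  refine ⟨ρ, (1 + N₀ ^ 2) * D + N₀ * D * Λ, hρ0, hρ1, by positivity, ?_⟩
  intro s Γ hΓ G hμ hG hGC
  set N : ℝ := gaussNorm Γ
  have hN0 : 0 < N := gaussNorm_pos hΓ
  have hN : N ≤ N₀ := gaussNorm_le hΓ hμ0 hμ
  have hbounds : ∀ z : Fin k → ℂ, (∀ i, z i ∈ complexBox K ρ) →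
      ‖complexEvidence Γ G z‖ ≤ D ∧ c ≤ (complexEvidence Γ G z).re := fun z hz =>
    complexEvidence_bounds hG
      (fun θ hθ => (complexGauss_bounds hΓ hμ0 hμ hρ1 le_rfl hρP hρ0.le hz (hGC θ hθ)).1)
      (fun θ hθ => (complexGauss_bounds hΓ hμ0 hμ hρ1 le_rfl hρP hρ0.le hz (hGC θ hθ)).2)
  refine ⟨fun z => N * complexEvidence Γ G z * (Real.log N + Complex.log (complexEvidence Γ G z)),
    ⟨fun z hz => ?_, fun j z hz => ?_⟩, fun y hy => ?_⟩
  · obtain ⟨h1, h2⟩ := hbounds z hz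
    set E := complexEvidence Γ G z
    have hE : c ≤ ‖E‖ := h2.trans ((le_abs_self _).trans (Complex.abs_re_le_norm E))
    have hE0 : 0 < ‖E‖ := hc0.trans_le hE
    have hlog : ‖Complex.log E‖ ≤ Λ := by
      refine (Complex.norm_le_abs_re_add_abs_im _).trans ?_
      rw [Complex.log_re, Complex.log_im]
      refine add_le_add ?_ (Complex.abs_arg_le_pi E)
      have hl1 := Real.log_le_log hc0 hE
      have hl2 := Real.log_le_log hE0 h1
      rw [abs_le]
      constructor <;> linarith [neg_abs_le (Real.log c), le_abs_self (Real.log D),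
        abs_nonneg (Real.log c), abs_nonneg (Real.log D)]
    -- `log N` has no bound uniform in `Γ`, so it is kept together with its factor `N`.
    have hsplit : (N : ℂ) * E * (Real.log N + Complex.log E) =
        ((N * Real.log N : ℝ) : ℂ) * E + N * E * Complex.log E := by
      push_cast; ring
    change ‖(N : ℂ) * E * (Real.log N + Complex.log E)‖ ≤ _
    rw [hsplit]
    refine (norm_add_le _ _).trans (add_le_add ?_ ?_)
    · rw [norm_mul, Complex.norm_real, Real.norm_eq_abs]
      exact mul_le_mul (abs_mul_log_le hN0 hN) h1 (norm_nonneg _) (by positivity)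
    · rw [norm_mul, norm_mul, Complex.norm_real, Real.norm_of_nonneg hN0.le]
      gcongr
  · have hE : DifferentiableOn ℂ (fun t => complexEvidence Γ G (Function.update z j t))
        (complexBox K ρ) := (differentiable_complexEvidence hG hGC z j).differentiableOn
    refine (hE.const_mul (N : ℂ)).mul (DifferentiableOn.const_add _ (hE.clog fun t ht => ?_))
    refine Or.inl (hc0.trans_le (hbounds _ fun i => ?_).2)
    by_cases hij : i = j
    · subst hij; simpa using ht
    · simpa [Function.update_of_ne hij] using hz i
  · have hbox : ∀ i, (y i : ℂ) ∈ complexBox K ρ := fun i =>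
      closedBall_subset_complexBox hρ1 (show y i ∈ Set.Icc (-K) K from ⟨hy.1 i, hy.2 i⟩)
        (Metric.mem_closedBall_self hρ0.le)
    have hre := (hbounds (fun i => (y i : ℂ)) hbox).2
    have hev := evidence_eq (G := G) hΓ y
    have hNC : (N : ℂ) ≠ 0 := by exact_mod_cast hN0.ne'
    have hE : complexEvidence Γ G (fun i => (y i : ℂ)) = ((evidence Γ G y / N : ℝ) : ℂ) := by
      push_cast
      rw [hev, mul_div_cancel_left₀ _ hNC]
    simp only [hE]
    rw [hE, Complex.ofReal_re] at hre
    have hq : 0 < evidence Γ G y / N := hc0.trans_le hre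
    rw [← Complex.ofReal_log hq.le]
    have hlog : Real.log N + Real.log (evidence Γ G y / N) = Real.log (evidence Γ G y) := by
      rw [← Real.log_mul hN0.ne' hq.ne', mul_div_cancel₀ _ hN0.ne']
    unfold outerIntegrand
    rw [← hlog]
    push_cast
    field_simp

/-! ### Positivity of the weights and assembly of the error bound. -/

theorem half_lt_lam {δ : ℝ} (hδ0 : 0 < δ) (hδ1 : δ < 1) : 1 / 2 < lam δ := by
  unfold lam
  exact one_div_lt_one_div_of_lt (by linarith) (by linarith)

theorem zetaReal_pos {x : ℝ} (hx : 1 < x) : 0 < zetaReal x := by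
  have hs : Summable fun l : ℕ => ((l : ℝ) + 1) ^ (-x) := by
    have := (summable_nat_add_iff 1).2 (Real.summable_nat_rpow.2 (show -x < -1 by linarith))
    simpa using this
  exact hs.tsum_pos (fun l => by positivity) 0 (by positivity)

theorem orderWeight_pos {k : ℕ} (hk : 1 ≤ k) {K C μ δ : ℝ} (hμ : 0 < μ) (hδ0 : 0 < δ)
    (hδ1 : δ < 1) (u : Finset (Fin k)) : 0 < orderWeight k K C μ δ u := by
  have hk0 : (0 : ℝ) < k := by exact_mod_cast hk
  have hlam := half_lt_lam hδ0 hδ1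
  have hζ : 0 < zetaReal (2 * lam δ) := zetaReal_pos (by linarith)
  have hlog : 0 < Real.log 2 := Real.log_pos one_lt_two
  have hpi := Real.pi_pos
  unfold orderWeight
  refine Real.rpow_pos_of_pos (mul_pos (by exact_mod_cast Nat.factorial_pos _)
    (Finset.prod_pos fun j _ => ?_)) _
  have : 0 < μ ^ (-(1 / 2) : ℝ) := Real.rpow_pos_of_pos hμ _
  positivity

theorem GevreyRegular.continuousOn_and_norm_le {k : ℕ} {Ξ : Type*} {C β : ℝ} {b : ℕ → ℝ}
    {G : (s : ℕ) → (Fin s → ℝ) → Ξ → EuclideanSpace ℝ (Fin k)} (hG : GevreyRegular C β b G)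
    {s : ℕ} (hs : 1 ≤ s) (ξ : Ξ) :
    ContinuousOn (fun θ => G s θ ξ) (paramCube s) ∧ ∀ θ ∈ paramCube s, ‖G s θ ξ‖ ≤ C := by
  obtain ⟨h1, h2⟩ := hG s hs ξ
  refine ⟨h1.continuousOn, fun θ hθ => ?_⟩
  have h := h2 (fun _ => 0) θ hθ
  simpa [mixedPartial] using h

end QMCDesign

theorem mainTheorem8
    (k : ℕ) (hk : 1 ≤ k) (K C μmin δ : ℝ) (hK : 0 < K) (hC : 1 ≤ C)
    (hμ0 : 0 < μmin) (hμ1 : μmin ≤ 1) (hδ0 : 0 < δ) (hδ1 : δ < 1) :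
    ∃ c : ℝ, 0 < c ∧
      ∀ (Ξ : Type*) (β p : ℝ) (b : ℕ → ℝ)
        (G : (s : ℕ) → (Fin s → ℝ) → Ξ → EuclideanSpace ℝ (Fin k))
        (Γ : Matrix (Fin k) (Fin k) ℝ) (hΓ : Γ.PosDef),
        1 ≤ β → 0 < p → p < 1 → (∀ j, 0 ≤ b j) → Summable (fun j => b j ^ p) →
        QMCDesign.GevreyRegular C β b G →
        (∀ i, μmin ≤ hΓ.isHermitian.eigenvalues i) →
        ∀ (s : ℕ), 1 ≤ s → ∀ ξ : Ξ,
          MeasureTheory.IntegrableOn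
            (QMCDesign.outerIntegrand Γ (fun θ => G s θ ξ)) (QMCDesign.dataCube k K) ∧
          ∀ (m n : ℕ), n = 2 ^ m →
            (∃ z : Fin k → ℕ,
              QMCDesign.IsCBCVector n (QMCDesign.orderWeight k K C μmin δ) z) ∧
            ∀ z : Fin k → ℕ,
              QMCDesign.IsCBCVector n (QMCDesign.orderWeight k K C μmin δ) z →
              ∀ R : ℕ, 1 ≤ R →
                MeasureTheory.MemLp
                  (QMCDesign.cubatureError n R K z
                    (QMCDesign.outerIntegrand Γ (fun θ => G s θ ξ)))
                  2 (QMCDesign.shiftLaw k R) ∧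
                QMCDesign.rmsError n R K z
                    (QMCDesign.outerIntegrand Γ (fun θ => G s θ ξ)) ≤
                  c * (n : ℝ) ^ (-1 + δ) := by
  obtain ⟨ρ, M, hρ0, hρ1, hM, hext⟩ :=
    QMCDesign.exists_holomorphic_extension k hk (K := K) hC hμ0
  -- The power inequality needs an exponent `lam η ≤ 1`, that is `η ≤ 1/2`. The rate `-1 + η` is at
  -- least as good as `-1 + δ`, while the weights keep their `δ`.
  have hη0 : 0 < min δ (1 / 2) := lt_min hδ0 (by norm_num)
  have hη1 : min δ (1 / 2) ≤ 1 / 2 := min_le_right _ _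
  have hηδ : min δ (1 / 2) ≤ δ := min_le_left _ _
  set η : ℝ := min δ (1 / 2)
  have hr0 : 1 / 2 < QMCDesign.lam η := QMCDesign.half_lt_lam hη0 (by linarith)
  have hr1 : QMCDesign.lam η ≤ 1 := by
    unfold QMCDesign.lam
    rw [div_le_one (by linarith)]
    linarith
  have hrinv : 1 / QMCDesign.lam η = 2 - 2 * η := by
    unfold QMCDesign.lam
    rw [one_div_one_div]
  obtain ⟨B, hB0, hB⟩ := QMCDesign.exists_latticeSum_le_of_isCBCVector
    (γ := QMCDesign.orderWeight k K C μmin δ)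
    (QMCDesign.orderWeight_pos hk hμ0 hδ0 hδ1) hr0 hr1
  set V : Finset (Fin k) → ℝ := fun u =>
    ((2 * K) ^ k * M) ^ 2 * (2 * Real.pi ^ 2 * (2 * K / ρ) ^ 2) ^ u.card
  have hV : ∀ u, 0 ≤ V u := fun u => by positivity
  set W : ℝ := ∑ u : Finset (Fin k) with u.Nonempty, V u * B
  have hW : 0 ≤ W := Finset.sum_nonneg fun u _ => mul_nonneg (hV u) hB0
  refine ⟨Real.sqrt W + 1, by positivity, ?_⟩
  intro Ξ β p b G Γ hΓ _ _ _ _ _ hG hμ s hs ξ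
  obtain ⟨hGc, hGC⟩ := hG.continuousOn_and_norm_le hs ξ
  have hcont : Continuous (QMCDesign.outerIntegrand Γ (fun θ => G s θ ξ)) :=
    Real.continuous_mul_log.comp (QMCDesign.continuous_evidence hΓ hGc)
  obtain ⟨Fc, hFc, hFcg⟩ := hext s Γ hΓ _ hμ hGc hGC
  refine ⟨hcont.integrableOn_Icc, ?_⟩
  rintro m n rfl
  refine ⟨QMCDesign.exists_isCBCVector Nat.one_le_two_pow _, fun z hz R hR => ?_⟩
  obtain ⟨hmem, hrms⟩ := QMCDesign.memLp_and_rmsError_le (n := 2 ^ m) (by positivity) z hK hcont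
    hρ0 hM (fun t ht => QMCDesign.closedBall_subset_complexBox hρ1 ht) hFc hFcg hR
  refine ⟨hmem, hrms.trans ?_⟩
  have hn1 : (1 : ℝ) ≤ ((2 ^ m : ℕ) : ℝ) := by exact_mod_cast Nat.one_le_two_pow
  have hn0 : (0 : ℝ) ≤ ((2 ^ m : ℕ) : ℝ) := by linarith
  -- Since `1 / lam η = 2 - 2η`, the lattice sums decay like the square of `n^{-1+η}`.
  have hsum : ∑ u : Finset (Fin k) with u.Nonempty, V u * QMCDesign.latticeSum (2 ^ m) z u ≤
      W * (((2 ^ m : ℕ) : ℝ) ^ (-1 + η)) ^ 2 := by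
    rw [Finset.sum_mul]
    refine Finset.sum_le_sum fun u hu => ?_
    rw [mul_assoc (V u) B]
    refine mul_le_mul_of_nonneg_left ?_ (hV u)
    refine (hB m z hz u (Finset.mem_filter.1 hu).2).trans_eq ?_
    rw [hrinv, ← Real.rpow_natCast (_ ^ (-1 + η)), ← Real.rpow_mul hn0]
    congr 2
    push_cast
    ring
  calc Real.sqrt (∑ u : Finset (Fin k) with u.Nonempty, V u * QMCDesign.latticeSum (2 ^ m) z u)
      ≤ Real.sqrt (W * (((2 ^ m : ℕ) : ℝ) ^ (-1 + η)) ^ 2) := Real.sqrt_le_sqrt hsum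
    _ = Real.sqrt W * ((2 ^ m : ℕ) : ℝ) ^ (-1 + η) := by
        rw [Real.sqrt_mul hW, Real.sqrt_sq (Real.rpow_nonneg hn0 _)]
    _ ≤ (Real.sqrt W + 1) * ((2 ^ m : ℕ) : ℝ) ^ (-1 + δ) := by
        refine mul_le_mul (by linarith) (Real.rpow_le_rpow_of_exponent_le hn1 (by linarith))
          (Real.rpow_nonneg hn0 _) (by positivity)
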